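/- Let $(B_i,A_i)_{i\ge 1}$ be independent copies of a random vector $(B,A)$ with values in $[0,\infty)^2$ and with an arbitrary joint distribution, let $h(s_1,s_2)=\mathbb E\,e^{-s_1B-s_2A}$, let $S_n=\sum_{i=1}^n (B_i-A_i)$ with $S_0=0$, and let $N=\min\{n: S_n<0\}$ ($N=\infty$ if there is no such $n$) be the number of customers served in a busy period, with the convention $z^\infty=0$. Assume that $\mathbb P(S_n=0)=0$ for all $n\ge 1$. For a function $\varphi$ on the imaginary axis let $$\oint_{-i\infty}^{i\infty}\frac{\varphi(\xi)}{\xi}\,d\xi := \lim_{T\to\infty}\lim_{\varepsilon\downarrow 0}\int_{\varepsilon<|\theta|\le T}\frac{\varphi(i\theta)}{\theta}\,d\theta+\pi i\,\varphi(\infty)-\pi i\,\varphi(0)$$ be the Cauchy integral over the imaginary axis, closed into a circle on the Riemann sphere whose interior is the left half-plane, with poles on the circle counted as lying outside it (the normalization in which $\oint\frac{d\xi}{\xi-s}$ equals $2\pi i$ for $\mathrm{Re}\,s<0$ and $0$ for $\mathrm{Re}\,s\ge 0$). Here $\varphi(\infty)=\lim_{T\to\infty}\frac1{2T}\int_{-T}^{T}\varphi(i\theta)\,d\theta$,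 which is the value of $\varphi$ at the point at infinity whenever $\varphi$ extends continuously to that point. Then for every complex $z$ with $|z|<1$ the integral below exists (that is, the limits and $\varphi(\infty)$ exist for its density $\varphi(\xi)=\log\frac{1-z\,h(\xi,-\xi)}{1-z}$, where $\log$ is the principal branch; note $\varphi(0)=0$), and $$\mathbb E\, z^N = 1-(1-z)\exp\Big\{\frac1{2\pi i}\oint_{-i\infty}^{i\infty}\frac{d\xi}{\xi}\,\log\frac{1-z\,h(\xi,-\xi)}{1-z}\Big\}.$$ -/

import Mathlib

open MeasureTheory ProbabilityTheory Filter Topology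

noncomputable section

namespace CorrelatedQueue

/-- The joint Laplace-Stieltjes transform `h(s₁, s₂) = E exp(-s₁ B - s₂ A)` of a pair `(B, A)`. -/
def jointLST {Ω : Type*} [MeasurableSpace Ω] (μ : Measure Ω) (B A : Ω → ℝ) (s₁ s₂ : ℂ) : ℂ :=
  ∫ ω, Complex.exp (-s₁ * (B ω : ℂ) - s₂ * (A ω : ℂ)) ∂μ

/-- The random walk `S_n`, with `S_0 = 0` and increments `B_i - A_i`. -/
def walk {Ω : Type*} (B A : ℕ → Ω → ℝ) (n : ℕ) (ω : Ω) : ℝ :=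
  ∑ i ∈ Finset.range n, (B i ω - A i ω)

/-- The number `N` of customers served in a busy period: the first `n` with `S_n < 0`, and `∞` if
the walk never becomes negative. -/
def numServed {Ω : Type*} (B A : ℕ → Ω → ℝ) (ω : Ω) : ℕ∞ :=
  sInf {m : ℕ∞ | ∃ n : ℕ, m = (n : ℕ∞) ∧ walk B A n ω < 0}

/-- The generating function `E z^N` of an extended-natural-number-valued random variable, with
`z^∞ = 0`. -/
def genFun {Ω : Type*} [MeasurableSpace Ω] (μ : Measure Ω) (N : Ω → ℕ∞) (z : ℂ) : ℂ :=
  ∫ ω, (if N ω = ⊤ then 0 else z ^ (N ω).toNat) ∂μ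

/-- The Cauchy integral `∫ φ(ξ) / (ξ - s) dξ` along the segment `[-iT, iT]` (`ξ = iθ`,
`dξ = i dθ`), a disc of radius `ε` around `s` being removed. -/
def truncatedCauchy (φ : ℂ → ℂ) (s : ℂ) (ε T : ℝ) : ℂ :=
  ∫ θ in {θ : ℝ | |θ| ≤ T ∧ ε < ‖(θ : ℂ) * Complex.I - s‖},
    φ ((θ : ℂ) * Complex.I) / ((θ : ℂ) * Complex.I - s) * Complex.I

/-- `J` is the double Cauchy principal value of `∫ φ(ξ) / (ξ - s) dξ` along the imaginary axis:
first the radius of the disc removed around `s` tends to `0`, and then the segment `[-iT, iT]`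
fills the axis. (For `s` off the axis the first limit does nothing.) -/
def HasDoublePV (φ : ℂ → ℂ) (s J : ℂ) : Prop :=
  ∃ F : ℝ → ℂ,
    (∀ T : ℝ, ‖s‖ < T → Tendsto (fun ε : ℝ => truncatedCauchy φ s ε T) (𝓝[>] 0) (𝓝 (F T))) ∧
    Tendsto F atTop (𝓝 J)

/-- `c` is the value at infinity of the density `φ` on the imaginary axis, in the mean:
`c = lim (1 / 2T) ∫_{-T}^{T} φ(iθ) dθ`. When `φ` extends continuously to the point at infinity of
the imaginary axis, this is its value there (`HasValueAtInfinity.of_tendsto`). -/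
def HasValueAtInfinity (φ : ℂ → ℂ) (c : ℂ) : Prop :=
  Tendsto (fun T : ℝ => ((2 * T : ℝ) : ℂ)⁻¹ * ∫ θ in (-T)..T, φ ((θ : ℂ) * Complex.I))
    atTop (𝓝 c)

open Classical in
/-- `K` is the Cauchy integral `∮ φ(ξ) / (ξ - s) dξ` along the imaginary axis, closed into a circle
through the point at infinity of the Riemann sphere, whose interior is the left half-plane: the
principal value along the axis, plus the contribution `π i φ(∞)` of the closing half-circle
in the left half-plane; a pole `s` on the circle counts as lying outside it, which contributes
`- π i φ(s)`. Thus the constant `1` has the integral `2 π i` for `Re s < 0`, and `0` for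
`Re s > 0` and for `Re s = 0`. -/
def HasSphereIntegral (φ : ℂ → ℂ) (s K : ℂ) : Prop :=
  LocallyIntegrable (fun θ : ℝ => φ ((θ : ℂ) * Complex.I)) ∧
  ∃ J c : ℂ, HasDoublePV φ s J ∧ HasValueAtInfinity φ c ∧
    K = J + Real.pi * Complex.I * c - (if s.re = 0 then Real.pi * Complex.I * φ s else 0)

/-- If `φ(iθ)` tends to `c` as `θ → ±∞`, then `c` is the value at infinity of `φ`. -/
theorem HasValueAtInfinity.of_tendsto {φ : ℂ → ℂ} {c : ℂ}
    (hφ : LocallyIntegrable (fun θ : ℝ => φ ((θ : ℂ) * Complex.I)))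
    (hc : Tendsto (fun θ : ℝ => φ ((θ : ℂ) * Complex.I)) (cocompact ℝ) (𝓝 c)) :
    HasValueAtInfinity φ c := by
  set g : ℝ → ℂ := fun θ => φ ((θ : ℂ) * Complex.I) with hg
  have hint : ∀ a b : ℝ, IntervalIntegrable g volume a b := fun a b =>
    (hφ.integrableOn_isCompact isCompact_uIcc).intervalIntegrable
  rw [HasValueAtInfinity, Metric.tendsto_atTop]
  intro ε hε
  have h1 : ∀ᶠ θ in cocompact ℝ, dist (g θ) c < ε / 2 := hc (Metric.ball_mem_nhds c (half_pos hε))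
  rw [← Metric.cobounded_eq_cocompact, ← comap_norm_atTop] at h1
  obtain ⟨M', hM'⟩ := (eventually_atTop.1 (eventually_comap.1 h1))
  set M : ℝ := max M' 1
  have hM : ∀ θ : ℝ, M ≤ |θ| → ‖g θ - c‖ ≤ ε / 2 := fun θ hθ => by
    have := hM' |θ| (le_trans (le_max_left _ _) hθ) θ rfl
    rw [dist_eq_norm] at this
    exact this.le
  have hM0 : 0 < M := lt_of_lt_of_le one_pos (le_max_right _ _)
  have hintc : ∀ a b : ℝ, IntervalIntegrable (fun θ => g θ - c) volume a b := fun a b =>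
    (hint a b).sub intervalIntegrable_const
  set C : ℝ := ‖∫ θ in (-M)..M, (g θ - c)‖ with hC
  refine ⟨max (M + 1) (C / ε + 1), fun T hT => ?_⟩
  have hTM : M + 1 ≤ T := le_trans (le_max_left _ _) hT
  have hTC : C / ε + 1 ≤ T := le_trans (le_max_right _ _) hT
  have hT0 : 0 < T := by linarith
  have hCT : C < ε * T := by
    have : C / ε < T := by linarith
    rwa [div_lt_iff₀ hε, mul_comm] at this
  have hTne : ((2 * T : ℝ) : ℂ) ≠ 0 := by
    exact_mod_cast (by positivity : (2 * T : ℝ) ≠ 0)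
  have e1 : ((2 * T : ℝ) : ℂ)⁻¹ * (∫ θ in (-T)..T, g θ) - c
      = ((2 * T : ℝ) : ℂ)⁻¹ * ∫ θ in (-T)..T, (g θ - c) := by
    rw [intervalIntegral.integral_sub (hint _ _) intervalIntegrable_const,
      intervalIntegral.integral_const]
    have : ((T - -T) • c : ℂ) = ((2 * T : ℝ) : ℂ) * c := by
      rw [Complex.real_smul]; congr 2; ring
    rw [this, mul_sub, inv_mul_cancel_left₀ hTne]
  have e2 : (∫ θ in (-T)..T, (g θ - c)) = (∫ θ in (-T)..(-M), (g θ - c))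
      + (∫ θ in (-M)..M, (g θ - c)) + ∫ θ in M..T, (g θ - c) := by
    rw [intervalIntegral.integral_add_adjacent_intervals (hintc _ _) (hintc _ _),
      intervalIntegral.integral_add_adjacent_intervals (hintc _ _) (hintc _ _)]
  have b1 : ‖∫ θ in (-T)..(-M), (g θ - c)‖ ≤ ε / 2 * |(-M) - (-T)| := by
    refine intervalIntegral.norm_integral_le_of_norm_le_const fun θ hθ => hM θ ?_
    rw [Set.uIoc_of_le (by linarith)] at hθ
    rw [abs_of_neg (by linarith [hθ.2])]
    linarith [hθ.2]
  have b2 : ‖∫ θ in M..T, (g θ - c)‖ ≤ ε / 2 * |T - M| := by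
    refine intervalIntegral.norm_integral_le_of_norm_le_const fun θ hθ => hM θ ?_
    rw [Set.uIoc_of_le (by linarith)] at hθ
    exact hθ.1.le.trans (le_abs_self _)
  rw [abs_of_nonneg (by linarith)] at b1 b2
  rw [dist_eq_norm, e1, norm_mul, norm_inv, Complex.norm_real, Real.norm_eq_abs,
    abs_of_pos (by positivity : (0 : ℝ) < 2 * T), inv_mul_lt_iff₀ (by positivity), e2]
  have n1 := norm_add₃_le (a := ∫ θ in (-T)..(-M), (g θ - c))
    (b := ∫ θ in (-M)..M, (g θ - c)) (c := ∫ θ in M..T, (g θ - c))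
  nlinarith

/-- The Cauchy integral over the closed imaginary axis has at most one value. -/
theorem HasSphereIntegral.unique {φ : ℂ → ℂ} {s K K' : ℂ}
    (h : HasSphereIntegral φ s K) (h' : HasSphereIntegral φ s K') : K = K' := by
  obtain ⟨-, J, c, ⟨F, hF, hJ⟩, hc, rfl⟩ := h
  obtain ⟨-, J', c', ⟨F', hF', hJ'⟩, hc', rfl⟩ := h'
  have hcc : c = c' := tendsto_nhds_unique hc hc'
  have hFF : F =ᶠ[atTop] F' := by
    filter_upwards [eventually_gt_atTop ‖s‖] with T hT
    exact tendsto_nhds_unique (hF T hT) (hF' T hT)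
  have hJJ : J = J' := tendsto_nhds_unique hJ (hJ'.congr' hFF.symm)
  rw [hcc, hJJ]

theorem hasValueAtInfinity_one : HasValueAtInfinity (fun _ => 1) 1 :=
  HasValueAtInfinity.of_tendsto continuous_const.locallyIntegrable tendsto_const_nhds

/-- The constant `1` has the integral `0` for the pole `0` on the axis. -/
theorem hasSphereIntegral_one_zero : HasSphereIntegral (fun _ => 1) 0 0 := by
  refine ⟨continuous_const.locallyIntegrable, 0, 1, ⟨fun _ => 0, fun T _ => ?_,
    tendsto_const_nhds⟩, hasValueAtInfinity_one, by simp⟩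
  have : ∀ ε, truncatedCauchy (fun _ => 1) 0 ε T = 0 := fun ε => by
    unfold truncatedCauchy
    set S := {θ : ℝ | |θ| ≤ T ∧ ε < ‖(θ : ℂ) * Complex.I - 0‖}
    have hS : MeasurableSet S := by
      have m1 : MeasurableSet {θ : ℝ | |θ| ≤ T} := measurableSet_le (by fun_prop) (by fun_prop)
      have m2 : MeasurableSet {θ : ℝ | ε < ‖(θ : ℂ) * Complex.I - 0‖} :=
        measurableSet_lt (by fun_prop) (by fun_prop)
      exact m1.inter m2
    rw [← integral_indicator hS]
    set G := S.indicator fun θ : ℝ => (1 : ℂ) / ((θ : ℂ) * Complex.I - 0) * Complex.I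
    have hodd : ∀ θ, G (-θ) = - G θ := fun θ => by
      by_cases h : θ ∈ S
      · have h' : -θ ∈ S := by simpa [S] using h
        simp only [G, Set.indicator_of_mem h, Set.indicator_of_mem h']
        simp
      · have h' : -θ ∉ S := by simpa [S] using h
        simp only [G, Set.indicator_of_notMem h, Set.indicator_of_notMem h', neg_zero]
    have h2 : ∫ θ, G θ = - ∫ θ, G θ := by
      rw [← integral_neg, ← integral_neg_eq_self]
      simp only [hodd]
    exact self_eq_neg.1 h2
  simp [this]

theorem tendsto_truncatedCauchy_of_re_ne_zero {φ : ℂ → ℂ} {s : ℂ} (hs : s.re ≠ 0) {T : ℝ} (hT : 0 < T) :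
    Tendsto (fun ε : ℝ => truncatedCauchy φ s ε T) (𝓝[>] 0)
      (𝓝 (∫ θ in (-T)..T, φ ((θ : ℂ) * Complex.I) / ((θ : ℂ) * Complex.I - s) * Complex.I)) := by
  refine tendsto_const_nhds.congr' ?_
  have : ∀ᶠ ε in 𝓝[>] (0 : ℝ), ε < |s.re| :=
    nhdsWithin_le_nhds (eventually_lt_nhds (abs_pos.2 hs))
  filter_upwards [this] with ε hε
  rw [truncatedCauchy, intervalIntegral.integral_of_le (by linarith), ← integral_Icc_eq_integral_Ioc]
  congr 2
  ext θ
  have h : ε < ‖(θ : ℂ) * Complex.I - s‖ := by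
    refine hε.trans_le ?_
    have := Complex.abs_re_le_norm ((θ : ℂ) * Complex.I - s)
    simpa using this
  simp [h, abs_le]

theorem tendsto_log_sub_log (s : ℂ) : Tendsto (fun T : ℝ => Complex.log (s - (T : ℂ) * Complex.I)
    - Complex.log (s + (T : ℂ) * Complex.I)) atTop (𝓝 (-(Real.pi * Complex.I))) := by
  have hst : Tendsto (fun T : ℝ => s / (T : ℂ)) atTop (𝓝 0) := by
    have h : Tendsto (fun T : ℝ => ((T⁻¹ : ℝ) : ℂ)) atTop (𝓝 ((0 : ℝ) : ℂ)) :=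
      (Complex.continuous_ofReal.tendsto _).comp tendsto_inv_atTop_zero
    simpa [div_eq_mul_inv] using h.const_mul s
  have h1 : Tendsto (fun T : ℝ => Complex.log (s / T - Complex.I)) atTop
      (𝓝 (Complex.log (-Complex.I))) := by
    have h : ContinuousAt Complex.log (-Complex.I) := continuousAt_clog (by simp [Complex.slitPlane])
    refine h.tendsto.comp ?_
    simpa using hst.sub_const Complex.I
  have h2 : Tendsto (fun T : ℝ => Complex.log (s / T + Complex.I)) atTop
      (𝓝 (Complex.log (Complex.I))) := by
    have h : ContinuousAt Complex.log (Complex.I) := continuousAt_clog (by simp [Complex.slitPlane])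
    refine h.tendsto.comp ?_
    simpa using hst.add_const Complex.I
  have h3 := h1.sub h2
  rw [Complex.log_neg_I, Complex.log_I] at h3
  have e : -(Real.pi / 2 : ℂ) * Complex.I - Real.pi / 2 * Complex.I = -(Real.pi * Complex.I) := by ring
  rw [e] at h3
  refine h3.congr' ?_
  have n1 := h1
  have c1 : ∀ᶠ T : ℝ in atTop, s / T - Complex.I ≠ 0 := by
    have : Tendsto (fun T : ℝ => s / T - Complex.I) atTop (𝓝 (0 - Complex.I)) := hst.sub_const _
    exact this.eventually_ne (by simp)
  have c2 : ∀ᶠ T : ℝ in atTop, s / T + Complex.I ≠ 0 := by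
    have : Tendsto (fun T : ℝ => s / T + Complex.I) atTop (𝓝 (0 + Complex.I)) := hst.add_const _
    exact this.eventually_ne (by simp)
  filter_upwards [eventually_gt_atTop 0, c1, c2] with T hT c1 c2
  have hT' : (T : ℂ) ≠ 0 := by exact_mod_cast hT.ne'
  have e1 : s - (T : ℂ) * Complex.I = (T : ℂ) * (s / T - Complex.I) := by field_simp
  have e2 : s + (T : ℂ) * Complex.I = (T : ℂ) * (s / T + Complex.I) := by field_simp
  rw [e1, e2, Complex.log_ofReal_mul hT c1, Complex.log_ofReal_mul hT c2]
  ring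

theorem integral_one_of_re_pos {s : ℂ} (hs : 0 < s.re) (T : ℝ) :
    ∫ θ in (-T)..T, (1 : ℂ) / ((θ : ℂ) * Complex.I - s) * Complex.I =
      Complex.log (s - (T : ℂ) * Complex.I) - Complex.log (s + (T : ℂ) * Complex.I) := by
  have hd : ∀ θ : ℝ, HasDerivAt (fun θ : ℝ => Complex.log (s - (θ : ℂ) * Complex.I))
      ((1 : ℂ) / ((θ : ℂ) * Complex.I - s) * Complex.I) θ := fun θ => by
    have h0 : HasDerivAt (fun θ : ℝ => s - (θ : ℂ) * Complex.I) (-(1 * Complex.I)) θ :=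
      ((Complex.ofRealCLM.hasDerivAt (x := θ)).mul_const Complex.I).const_sub s
    have := h0.clog_real (by left; simpa using hs)
    convert this using 1
    rw [← neg_sub s, div_neg]; ring
  rw [intervalIntegral.integral_eq_sub_of_hasDerivAt (fun θ _ => hd θ)]
  · simp
  · apply Continuous.intervalIntegrable
    refine Continuous.mul (Continuous.div continuous_const (by fun_prop) fun θ h => ?_) continuous_const
    have := congrArg Complex.re h
    simp at this
    exact hs.ne' this

/-- The constant `1` has the integral `0` for a pole in the right half-plane. -/
theorem hasSphereIntegral_one_of_re_pos {s : ℂ} (hs : 0 < s.re) : HasSphereIntegral (fun _ => 1) s 0 := by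
  refine ⟨continuous_const.locallyIntegrable, -(Real.pi * Complex.I), 1, ⟨_, fun T hT =>
    tendsto_truncatedCauchy_of_re_ne_zero hs.ne' ((norm_nonneg _).trans_lt hT), ?_⟩, hasValueAtInfinity_one, by
      simp [hs.ne']⟩
  simp only [integral_one_of_re_pos hs]
  exact tendsto_log_sub_log s

/-- The constant `1` has the integral `2 π i` for a pole in the left half-plane. -/
theorem hasSphereIntegral_one_of_re_neg {s : ℂ} (hs : s.re < 0) :
    HasSphereIntegral (fun _ => 1) s (2 * Real.pi * Complex.I) := by
  refine ⟨continuous_const.locallyIntegrable, (Real.pi * Complex.I), 1, ⟨_, fun T hT =>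
    tendsto_truncatedCauchy_of_re_ne_zero hs.ne ((norm_nonneg _).trans_lt hT), ?_⟩, hasValueAtInfinity_one, by
      simp [hs.ne]; ring⟩
  have key : ∀ T : ℝ, ∫ θ in (-T)..T, (1 : ℂ) / ((θ : ℂ) * Complex.I - s) * Complex.I =
      -(Complex.log (-s - (T : ℂ) * Complex.I) - Complex.log (-s + (T : ℂ) * Complex.I)) := fun T => by
    rw [← integral_one_of_re_pos (s := -s) (by simpa using hs), ← intervalIntegral.integral_neg]
    have := intervalIntegral.integral_comp_neg (a := -T) (b := T)
      (fun θ : ℝ => (1 : ℂ) / ((θ : ℂ) * Complex.I - s) * Complex.I)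
    rw [neg_neg] at this
    rw [← this]
    congr 1; ext θ
    push_cast
    rw [show -(θ : ℂ) * Complex.I - s = -((θ : ℂ) * Complex.I - -s) by ring, div_neg]; ring
  simp only [key]
  simpa using (tendsto_log_sub_log (-s)).neg

end CorrelatedQueue

end

/-! On the axis, `h(iθ, -iθ)` is the characteristic function χ of `B - A` at `-θ`, and χⁿ belongs to
`S_n`. Hence the density is ∑ zⁿ/n (1 - E exp(-iθ S_n)), absolutely summable uniformly in θ, and the
integral can be computed term by term. In one term the principal value keeps only the odd part,
which is 2i times the mean of the sine integral of `T S_n`; as T → ∞ it tends to πi E sgn S_n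
(`hasDoublePV_charSeries`). The value at infinity is 1 - P(S_n = 0) (`tendsto_mean_charSeries`).
Together these give 2πi P(S_n > 0), which without ties is 2πi (1 - P(S_n < 0)). The exponential is
therefore (1 - z)⁻¹ exp(-∑ zⁿ/n P(S_n < 0)).

What remains is Sparre Andersen's identity 1 - E z^N = exp(-∑ zⁿ/n P(S_n < 0))
(`one_sub_genFun_numServed`). Let G be the generating series of the laws of the walk while it stays
nonnegative, and H that of its position when it is first negative. Then (1 - χX) G = 1 - H. Take
logarithmic derivatives and separate what is carried by the negative half-line from what is carried
by the nonnegative one: a difference of finite measures carried by both is zero. This is done in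
formal power series over functions of the frequency (`wienerHopf_recurrence`). Total masses then
satisfy a recurrence, which a differential equation in z turns into the exponential
(`one_sub_tsum_eq_exp`). -/

noncomputable section

namespace CorrelatedQueue

/-! ### The sine integral: its limit and a uniform bound -/

section

/-- The sine integral `∫₀ˣ sin t / t dt`. -/
def sineIntegral (x : ℝ) : ℝ := ∫ t in (0 : ℝ)..x, Real.sinc t

theorem sineIntegral_zero : sineIntegral 0 = 0 := by simp [sineIntegral]

theorem sineIntegral_neg (x : ℝ) : sineIntegral (-x) = -sineIntegral x := by
  have h := intervalIntegral.integral_comp_neg (a := 0) (b := x) Real.sinc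
  rw [neg_zero] at h
  rw [sineIntegral, sineIntegral, intervalIntegral.integral_symm, ← h]
  simp [Real.sinc_neg]

theorem continuous_sineIntegral : Continuous sineIntegral :=
  intervalIntegral.continuous_primitive
    (fun _ _ => Real.continuous_sinc.intervalIntegrable _ _) 0

/-- Writing 1/x as the Laplace integral of `exp (-x t)` makes the sine integral a double integral,
to be evaluated in the other order. -/
theorem sinc_eq_integral {x : ℝ} (hx : 0 < x) :
    Real.sinc x = ∫ t in Set.Ioi (0 : ℝ), Real.exp (-(x * t)) * Real.sin x := by
  rw [integral_mul_const, Real.sinc_of_ne_zero hx.ne']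
  have := integral_exp_mul_Ioi (a := -x) (by linarith) 0
  simp only [neg_mul] at this
  rw [this]
  simp
  field_simp

theorem integral_exp_mul_sin (t T : ℝ) :
    ∫ x in (0 : ℝ)..T, Real.exp (-(x * t)) * Real.sin x =
      (1 + t ^ 2)⁻¹ - Real.exp (-(T * t)) * ((t * Real.sin T + Real.cos T) / (1 + t ^ 2)) := by
  have ht : (1 + t ^ 2) ≠ 0 := by positivity
  have hd : ∀ x : ℝ, HasDerivAt
      (fun x : ℝ => -(Real.exp (-(x * t)) * ((t * Real.sin x + Real.cos x) / (1 + t ^ 2))))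
      (Real.exp (-(x * t)) * Real.sin x) x := fun x => by
    have h1 : HasDerivAt (fun x : ℝ => Real.exp (-(x * t))) (Real.exp (-(x * t)) * (-(1 * t))) x :=
      (((hasDerivAt_id x).mul_const t).neg).exp
    have h2 : HasDerivAt (fun x : ℝ => (t * Real.sin x + Real.cos x) / (1 + t ^ 2))
      ((t * Real.cos x + -Real.sin x) / (1 + t ^ 2)) x :=
      (((Real.hasDerivAt_sin x).const_mul t).add (Real.hasDerivAt_cos x)).div_const _
    convert! (h1.mul h2).neg using 1
    field_simp
    ring
  rw [intervalIntegral.integral_eq_sub_of_hasDerivAt (fun x _ => hd x)]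
  · simp
    ring
  · apply Continuous.intervalIntegrable
    fun_prop

/-- Integrating the absolute value over t first leaves |sinc x|, which is integrable on the bounded
interval. -/
theorem integrable_exp_mul_sin {T : ℝ} (hT : 0 < T) :
    Integrable (Function.uncurry fun x t : ℝ => Real.exp (-(x * t)) * Real.sin x)
      ((volume.restrict (Set.uIoc 0 T)).prod (volume.restrict (Set.Ioi 0))) := by
  have hm : Continuous (Function.uncurry fun x t : ℝ => Real.exp (-(x * t)) * Real.sin x) := by
    fun_prop
  rw [Set.uIoc_of_le hT.le, integrable_prod_iff hm.aestronglyMeasurable]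
  refine ⟨(ae_restrict_iff' measurableSet_Ioc).2 (Eventually.of_forall fun x hx => ?_), ?_⟩
  · have := integrableOn_exp_mul_Ioi (a := -x) (by linarith [hx.1]) 0
    simp only [neg_mul] at this
    exact Integrable.mul_const this (Real.sin x)
  · refine (Real.continuous_sinc.abs.integrableOn_Ioc (a := 0) (b := T)).congr
      ((ae_restrict_iff' measurableSet_Ioc).2 (Eventually.of_forall fun x hx => ?_))
    simp only [Function.uncurry_apply_pair, norm_mul, Real.norm_eq_abs, Real.abs_exp]
    rw [sinc_eq_integral hx.1, integral_mul_const, integral_mul_const, abs_mul, abs_of_nonneg]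
    exact integral_nonneg fun _ => (Real.exp_pos _).le

theorem abs_exp_mul_sin_add_cos_div_le (t T : ℝ) (ht : 0 ≤ t) :
    ‖Real.exp (-(T * t)) * ((t * Real.sin T + Real.cos T) / (1 + t ^ 2))‖
      ≤ Real.exp (-T * t) * 2 := by
  rw [norm_mul, Real.norm_eq_abs, Real.abs_exp, neg_mul]
  gcongr
  rw [Real.norm_eq_abs, abs_div, abs_of_pos (by positivity : 0 < 1 + t ^ 2),
    div_le_iff₀ (by positivity)]
  have h1 : |t * Real.sin T + Real.cos T| ≤ t * 1 + 1 := by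
    refine (abs_add_le _ _).trans ?_
    rw [abs_mul, abs_of_nonneg ht]
    gcongr
    · exact Real.abs_sin_le_one T
    · exact Real.abs_cos_le_one T
  -- The factor 2 is crude: t + 1 ≤ 2 (1 + t²).
  nlinarith [sq_nonneg (t - 1)]

theorem integrableOn_exp_mul_sin_add_cos_div {T : ℝ} (hT : 0 < T) : IntegrableOn
    (fun t : ℝ => Real.exp (-(T * t)) * ((t * Real.sin T + Real.cos T) / (1 + t ^ 2)))
    (Set.Ioi 0) := by
  refine ((integrableOn_exp_mul_Ioi (a := -T) (by linarith) 0).mul_const 2).mono'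
    (Continuous.aestronglyMeasurable ?_)
    ((ae_restrict_iff' measurableSet_Ioi).2 (Eventually.of_forall fun t ht =>
      abs_exp_mul_sin_add_cos_div_le t T (le_of_lt ht)))
  refine Continuous.mul (by fun_prop) (Continuous.div (by fun_prop) (by fun_prop) fun t => ?_)
  positivity

/-- By Fubini the x-integral is elementary; its constant part 1/(1 + t²) integrates to π/2 and the
rest decays with T. -/
theorem sineIntegral_eq {T : ℝ} (hT : 0 < T) : sineIntegral T = Real.pi / 2 -
    ∫ t in Set.Ioi (0 : ℝ), Real.exp (-(T * t)) * ((t * Real.sin T + Real.cos T) / (1 + t ^ 2)) := by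
  have h1 : sineIntegral T =
      ∫ x in (0 : ℝ)..T, ∫ t in Set.Ioi (0 : ℝ), Real.exp (-(x * t)) * Real.sin x := by
    refine intervalIntegral.integral_congr_ae (Eventually.of_forall fun x hx => ?_)
    rw [Set.uIoc_of_le hT.le] at hx
    exact sinc_eq_integral hx.1
  rw [h1, intervalIntegral_integral_swap (integrable_exp_mul_sin hT)]
  simp only [integral_exp_mul_sin]
  rw [integral_sub integrable_inv_one_add_sq.integrableOn
    (integrableOn_exp_mul_sin_add_cos_div hT), integral_Ioi_inv_one_add_sq]
  simp

theorem abs_pi_div_two_sub_sineIntegral_le {T : ℝ} (hT : 0 < T) :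
    |Real.pi / 2 - sineIntegral T| ≤ 2 / T := by
  rw [sineIntegral_eq hT, sub_sub_cancel]
  have h := norm_integral_le_of_norm_le
    ((integrableOn_exp_mul_Ioi (a := -T) (by linarith) 0).mul_const 2)
    ((ae_restrict_iff' measurableSet_Ioi).2 (Eventually.of_forall fun t ht =>
      abs_exp_mul_sin_add_cos_div_le t T (le_of_lt ht)))
  refine h.trans (le_of_eq ?_)
  rw [integral_mul_const, integral_exp_mul_Ioi (by linarith)]
  simp
  field_simp

theorem tendsto_sineIntegral : Tendsto sineIntegral atTop (𝓝 (Real.pi / 2)) := by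
  have h : Tendsto (fun T : ℝ => 2 / T) atTop (𝓝 0) := tendsto_const_nhds.div_atTop tendsto_id
  rw [tendsto_iff_norm_sub_tendsto_zero]
  refine squeeze_zero' (Eventually.of_forall fun _ => norm_nonneg _) ?_ h
  filter_upwards [eventually_gt_atTop 0] with T hT
  rw [norm_sub_rev]
  exact abs_pi_div_two_sub_sineIntegral_le hT

/-- This is the dominating constant for all later limits. Up to 1 the bound |sinc| ≤ 1 suffices;
beyond, the value is within 2 of π/2 ≤ 2. Negative arguments follow by oddness. -/
theorem abs_sineIntegral_le (x : ℝ) : |sineIntegral x| ≤ 4 := by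
  have key : ∀ x : ℝ, 0 ≤ x → |sineIntegral x| ≤ 4 := fun x hx => by
    rcases le_total x 1 with h1 | h1
    · have := intervalIntegral.norm_integral_le_of_norm_le_const (a := 0) (b := x) (f := Real.sinc)
        (C := 1) (fun t _ => Real.abs_sinc_le_one t)
      rw [Real.norm_eq_abs, sub_zero, abs_of_nonneg hx] at this
      exact this.trans (by linarith)
    · have h := abs_pi_div_two_sub_sineIntegral_le (by linarith : 0 < x)
      have h2 : 2 / x ≤ 2 := div_le_self (by norm_num) h1
      have h3 := Real.pi_pos
      have h4 := Real.pi_le_four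
      rw [abs_le] at h ⊢
      constructor <;> linarith
  rcases le_total 0 x with h | h
  · exact key x h
  · have := key (-x) (by linarith)
    rwa [sineIntegral_neg, abs_neg] at this

end

/-! ### Differences of finite measures, through characteristic functions -/

section

/-- The characteristic functions of differences of finite measures that are carried by `s`. -/
def charFunsOn (s : Set ℝ) : Set (ℝ → ℂ) :=
  {f | ∃ ν₁ ν₂ : Measure ℝ, IsFiniteMeasure ν₁ ∧ IsFiniteMeasure ν₂ ∧ ν₁ sᶜ = 0 ∧ ν₂ sᶜ = 0 ∧
    f = charFun ν₁ - charFun ν₂}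

variable {s : Set ℝ} {f g : ℝ → ℂ}

theorem charFun_add_measure (ν₁ ν₂ : Measure ℝ) [IsFiniteMeasure ν₁] [IsFiniteMeasure ν₂] :
    charFun (ν₁ + ν₂) = charFun ν₁ + charFun ν₂ := by
  ext t
  have h : ∀ ν : Measure ℝ, IsFiniteMeasure ν →
      Integrable (fun x : ℝ => Complex.exp (t * x * Complex.I)) ν := fun ν _ => by
    refine (integrable_const (1 : ℝ)).mono' (by fun_prop) (Eventually.of_forall fun x => ?_)
    rw [← Complex.ofReal_mul, Complex.norm_exp_ofReal_mul_I]
  simp only [charFun_apply_real, Pi.add_apply]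
  exact integral_add_measure (h _ inferInstance) (h _ inferInstance)

theorem charFun_mem_charFunsOn {ν : Measure ℝ} [IsFiniteMeasure ν] (h : ν sᶜ = 0) :
    charFun ν ∈ charFunsOn s :=
  ⟨ν, 0, inferInstance, inferInstance, h, by simp, by ext; simp⟩

theorem zero_mem_charFunsOn : 0 ∈ charFunsOn s :=
  ⟨0, 0, inferInstance, inferInstance, by simp, by simp, by simp⟩

theorem charFunsOn.neg (hf : f ∈ charFunsOn s) : -f ∈ charFunsOn s := by
  obtain ⟨ν₁, ν₂, i₁, i₂, h₁, h₂, rfl⟩ := hf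
  exact ⟨ν₂, ν₁, i₂, i₁, h₂, h₁, by simp⟩

theorem charFunsOn.add (hf : f ∈ charFunsOn s) (hg : g ∈ charFunsOn s) : f + g ∈ charFunsOn s := by
  obtain ⟨ν₁, ν₂, i₁, i₂, h₁, h₂, rfl⟩ := hf
  obtain ⟨ρ₁, ρ₂, j₁, j₂, k₁, k₂, rfl⟩ := hg
  refine ⟨ν₁ + ρ₁, ν₂ + ρ₂, inferInstance, inferInstance, by simp [h₁, k₁], by simp [h₂, k₂], ?_⟩
  rw [charFun_add_measure, charFun_add_measure]
  ring

/-- The measures carried by an additive subsemigroup `s` are closed under convolution. -/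
theorem conv_compl_eq_zero (hs : MeasurableSet s) (hadd : ∀ x ∈ s, ∀ y ∈ s, x + y ∈ s)
    {ν ρ : Measure ℝ} [IsFiniteMeasure ν] [IsFiniteMeasure ρ] (h₁ : ν sᶜ = 0) (h₂ : ρ sᶜ = 0) :
    (ν ∗ ρ) sᶜ = 0 := by
  rw [Measure.conv, Measure.map_apply (by fun_prop) hs.compl]
  refine measure_mono_null (t := (sᶜ ×ˢ Set.univ) ∪ (Set.univ ×ˢ sᶜ)) (fun p hp => ?_) ?_
  · simp only [Set.mem_union, Set.mem_prod, Set.mem_univ, and_true, true_and, Set.mem_compl_iff]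
    by_contra! h
    exact hp (hadd _ h.1 _ h.2)
  · rw [measure_union_null_iff]
    simp [Measure.prod_prod, h₁, h₂]

theorem charFunsOn.mul (hs : MeasurableSet s) (hadd : ∀ x ∈ s, ∀ y ∈ s, x + y ∈ s)
    (hf : f ∈ charFunsOn s) (hg : g ∈ charFunsOn s) : f * g ∈ charFunsOn s := by
  obtain ⟨ν₁, ν₂, i₁, i₂, h₁, h₂, rfl⟩ := hf
  obtain ⟨ρ₁, ρ₂, j₁, j₂, k₁, k₂, rfl⟩ := hg
  refine ⟨ν₁ ∗ ρ₁ + ν₂ ∗ ρ₂, ν₁ ∗ ρ₂ + ν₂ ∗ ρ₁, inferInstance, inferInstance, ?_, ?_, ?_⟩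
  · simp [conv_compl_eq_zero hs hadd h₁ k₁, conv_compl_eq_zero hs hadd h₂ k₂]
  · simp [conv_compl_eq_zero hs hadd h₁ k₂, conv_compl_eq_zero hs hadd h₂ k₁]
  · rw [charFun_add_measure, charFun_add_measure]
    ext t
    simp only [Pi.mul_apply, Pi.sub_apply, Pi.add_apply, charFun_conv]
    ring

/-- Moving the subtracted measures across gives an equality of finite measures, by uniqueness of
characteristic functions. On subsets of `s` the measures carried by the complement disappear. This
is the uniqueness behind the Wiener–Hopf separation. -/
theorem charFunsOn.eq_zero (hs : MeasurableSet s) (hf : f ∈ charFunsOn s)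
    (hf' : f ∈ charFunsOn sᶜ) : f = 0 := by
  obtain ⟨ν₁, ν₂, i₁, i₂, h₁, h₂, rfl⟩ := hf
  obtain ⟨ρ₁, ρ₂, j₁, j₂, k₁, k₂, hE⟩ := hf'
  rw [compl_compl] at k₁ k₂
  have e : ν₁ + ρ₂ = ν₂ + ρ₁ := by
    apply Measure.ext_of_charFun
    rw [charFun_add_measure, charFun_add_measure]
    linear_combination hE
  have h : ν₁ = ν₂ := by
    ext t ht
    have split : ∀ ν : Measure ℝ, ν sᶜ = 0 → ν t = ν (t ∩ s) := fun ν h => by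
      rw [← measure_inter_add_sdiff t hs, measure_mono_null (fun x hx => hx.2 : t \ s ⊆ sᶜ) h,
        add_zero]
    have hz : ∀ ν : Measure ℝ, ν s = 0 → ν (t ∩ s) = 0 := fun ν h =>
      measure_mono_null Set.inter_subset_right h
    have := congrArg (fun ν : Measure ℝ => ν (t ∩ s)) e
    simp only [Measure.add_apply, hz _ k₁, hz _ k₂, add_zero] at this
    rw [split _ h₁, split _ h₂, this]
  simp [h]

end

/-! ### Wiener–Hopf factorization and the recurrence for the first negative time -/

section

open PowerSeries in
theorem coeff_mul_of_forall_lt {R : Type*} [CommRing R] {F G : PowerSeries R} {n : ℕ}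
    (hF : ∀ k < n, coeff k F = 0) (hG : coeff 0 G = 1) : coeff n (F * G) = coeff n F := by
  rw [coeff_mul, Finset.sum_eq_single (n, 0)]
  · simp [-coeff_zero_eq_constantCoeff, hG]
  · rintro ⟨i, j⟩ hij hne
    rw [Finset.HasAntidiagonal.mem_antidiagonal] at hij
    have : i < n := by
      rcases Nat.lt_or_ge i n with h | h
      · exact h
      · exact absurd (by ext <;> simp <;> omega) hne
    simp [hF i this]
  · simp

open PowerSeries in
/-- A Wiener–Hopf factorization `(1 - a X) G = 1 - H`, with the coefficients of `G` in a subring `P`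
and those of `H` in a subring `M` that meets `P` in `0` only, determines the logarithmic derivative
of `1 - H`: it is the part in `M` of the logarithmic derivative of `1 - a X`. -/
theorem wienerHopf_recurrence {R : Type*} [CommRing R] (M P : NonUnitalSubring R)
    (hMP : ∀ x ∈ M, x ∈ P → x = 0) (a : R) (lm lp g h : ℕ → R)
    (hlm : ∀ n, lm n ∈ M) (hlp : ∀ n, lp n ∈ P) (hg : ∀ n, g n ∈ P) (hh : ∀ n, h n ∈ M)
    (hg0 : g 0 = 1) (hh0 : h 0 = 0) (hlm0 : lm 0 = 0) (hlp0 : lp 0 = 0)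
    (hrec : ∀ n, g (n + 1) + h (n + 1) = a * g n)
    (hl : ∀ n, lm (n + 1) + lp (n + 1) = a ^ (n + 1)) (n : ℕ) :
    (n : R) * h n = lm n - ∑ p ∈ Finset.HasAntidiagonal.antidiagonal n, lm p.1 * h p.2 := by
  set G := PowerSeries.mk g with hG
  set H := PowerSeries.mk h with hH
  set Lm := PowerSeries.mk lm with hLm
  set Lp := PowerSeries.mk lp with hLp
  -- The Euler operator multiplies the n-th coefficient by n, so the argument needs no division in
  -- `R`.
  set D : PowerSeries R → PowerSeries R := fun F => X * derivative R F with hD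
  have cD : ∀ (F : PowerSeries R) (n : ℕ), coeff n (D F) = n * coeff n F := fun F n => by
    cases n with
    | zero => simp [hD]
    | succ n => simp [hD, coeff_succ_X_mul, coeff_derivative, mul_comm]
  have hcc : ∀ f : ℕ → R, constantCoeff (PowerSeries.mk f) = f 0 := fun f => by
    rw [← coeff_zero_eq_constantCoeff_apply, coeff_mk]
  have e1 : (1 - C a * X) * G = 1 - H := by
    ext n
    cases n with
    | zero => simp [hG, hH, hg0, hh0, hcc, sub_mul, mul_assoc]
    | succ n =>
      have := hrec n
      simp [hG, hH, sub_mul, mul_assoc, coeff_succ_X_mul, coeff_one]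
      linear_combination this
  -- Thus `Lm + Lp` is minus the logarithmic derivative (for `D`) of 1 - aX.
  have e2 : (1 - C a * X) * (Lm + Lp) = C a * X := by
    ext n
    cases n with
    | zero =>
      simp [hLm, hLp, hlm0, hlp0, hcc, sub_mul, mul_assoc]
    | succ n =>
      cases n with
      | zero =>
        have := hl 0
        simp [hLm, hLp, hlm0, hlp0, sub_mul, mul_assoc, coeff_succ_X_mul,
          hcc] at this ⊢
        exact this
      | succ n =>
        have h1 := hl (n + 1)
        have h2 := hl n
        simp [hLm, hLp, sub_mul, mul_assoc, coeff_succ_X_mul]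
        linear_combination h1 - a * h2
  have e3 : - (C a * X) * G + (1 - C a * X) * D G = - D H := by
    have := congrArg D e1
    simp only [hD, Derivation.leibniz, map_sub, smul_eq_mul] at this ⊢
    simp only [derivative_C, derivative_X, Derivation.map_one_eq_zero] at this
    linear_combination this
  -- The logarithmic derivative of `e1` reads Lm - DH/(1 - H) = DG/G - Lp. Its two sides are U/(1 -
  -- H) and V/G, and clearing denominators gives `e4`.
  set U := Lm * (1 - H) - D H with hU
  set V := D G - Lp * G with hV
  have e4 : U * G = V * (1 - H) := by
    rw [hU, hV]
    linear_combination (D G) * e1 - G * e3 + (-(Lm + Lp) * G) * e1 + G * G * e2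
  have cU : ∀ n, coeff n U = lm n - ∑ p ∈ Finset.HasAntidiagonal.antidiagonal n, lm p.1 * h p.2 - n * h n :=
    fun n => by
      rw [hU, map_sub, cD, mul_sub, mul_one, map_sub, coeff_mul]
      simp [hLm, hH]
  have cV : ∀ n, coeff n V = n * g n - ∑ p ∈ Finset.HasAntidiagonal.antidiagonal n, lp p.1 * g p.2 := fun n => by
    rw [hV, map_sub, cD, coeff_mul]
    simp [hLp, hG]
  have mU : ∀ n, coeff n U ∈ M := fun n => by
    -- The subring has no unit, so the factor n must act as a repeated sum.
    rw [cU, ← nsmul_eq_mul]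
    exact sub_mem (sub_mem (hlm n) (sum_mem fun p _ => mul_mem (hlm _) (hh _))) (nsmul_mem (hh n) n)
  have mV : ∀ n, coeff n V ∈ P := fun n => by
    rw [cV, ← nsmul_eq_mul]
    exact sub_mem (nsmul_mem (hg n) n) (sum_mem fun p _ => mul_mem (hlp _) (hg _))
  -- Once all lower coefficients vanish, `e4` says that the n-th coefficients of U and V agree, `G`
  -- and `1 - H` having constant term 1. Their common value lies in both subrings, so it is 0.
  have key : ∀ n, coeff n U = 0 ∧ coeff n V = 0 := fun n => by
    induction n using Nat.strong_induction_on with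
    | _ n ih =>
      have h1 := congrArg (coeff n) e4
      rw [coeff_mul_of_forall_lt (fun k hk => (ih k hk).1) (by simp [hG, hg0]),
        coeff_mul_of_forall_lt (fun k hk => (ih k hk).2) (by simp [hH, hh0])] at h1
      have h0 := hMP _ (mU n) (h1 ▸ mV n)
      exact ⟨h0, h1 ▸ h0⟩
  have := (key n).1
  rw [cU] at this
  linear_combination -this

variable {s : Set ℝ}

/-- The differences of finite measures carried by a measurable additive subsemigroup `s` of `ℝ` form
a ring under convolution; here it is represented by the characteristic functions. -/
def charFunRing (s : Set ℝ) (hs : MeasurableSet s) (hadd : ∀ x ∈ s, ∀ y ∈ s, x + y ∈ s) :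
    NonUnitalSubring (ℝ → ℂ) where
  carrier := charFunsOn s
  add_mem' := charFunsOn.add
  zero_mem' := zero_mem_charFunsOn
  neg_mem' := charFunsOn.neg
  mul_mem' := charFunsOn.mul hs hadd

variable (ν : Measure ℝ)

/-- The law of the `n`-th position of the random walk with step law `ν`. -/
def walkLaw (n : ℕ) : Measure ℝ :=
  match n with
  | 0 => Measure.dirac 0
  | n + 1 => walkLaw n ∗ ν

/-- The law of the `n`-th position of the random walk with step law `ν`, on the event that the walk
has not been negative up to then. -/
def nonnegLaw (n : ℕ) : Measure ℝ :=
  match n with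
  | 0 => Measure.dirac 0
  | n + 1 => (nonnegLaw n ∗ ν).restrict (Set.Ici 0)

/-- The law of the `n`-th position of the random walk with step law `ν`, on the event that the walk
is negative then for the first time. -/
def firstNegLaw (n : ℕ) : Measure ℝ :=
  match n with
  | 0 => 0
  | n + 1 => (nonnegLaw ν n ∗ ν).restrict (Set.Iio 0)

instance isProbabilityMeasure_walkLaw [IsProbabilityMeasure ν] (n : ℕ) :
    IsProbabilityMeasure (walkLaw ν n) := by
  induction n with
  | zero => rw [walkLaw]; infer_instance
  | succ n ih => rw [walkLaw]; infer_instance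

instance isFiniteMeasure_nonnegLaw [IsFiniteMeasure ν] (n : ℕ) :
    IsFiniteMeasure (nonnegLaw ν n) := by
  induction n with
  | zero => rw [nonnegLaw]; infer_instance
  | succ n ih => rw [nonnegLaw]; infer_instance

instance isFiniteMeasure_firstNegLaw [IsFiniteMeasure ν] (n : ℕ) :
    IsFiniteMeasure (firstNegLaw ν n) := by
  cases n with
  | zero => rw [firstNegLaw]; infer_instance
  | succ n => rw [firstNegLaw]; infer_instance

theorem charFun_walkLaw [IsProbabilityMeasure ν] (n : ℕ) :
    charFun (walkLaw ν n) = charFun ν ^ n := by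
  induction n with
  | zero => ext; simp [walkLaw]
  | succ n ih => ext t; rw [walkLaw, charFun_conv, ih, pow_succ]; rfl

theorem charFun_restrict_mem_charFunsOn (ρ : Measure ℝ) [IsFiniteMeasure ρ] (hs : MeasurableSet s) :
    charFun (ρ.restrict s) ∈ charFunsOn s :=
  charFun_mem_charFunsOn (by rw [Measure.restrict_apply hs.compl, Set.compl_inter_self, measure_empty])

theorem charFun_restrict_add_compl (ρ : Measure ℝ) [IsFiniteMeasure ρ] (hs : MeasurableSet s) :
    charFun (ρ.restrict s) + charFun (ρ.restrict sᶜ) = charFun ρ := by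
  rw [← charFun_add_measure, Measure.restrict_add_restrict_compl hs]

/-- The recurrence of Sparre Andersen for the distribution of the first time at which a random walk
is negative. -/
theorem natCast_mul_firstNegLaw [IsProbabilityMeasure ν] (n : ℕ) :
    (n : ℝ) * (firstNegLaw ν n).real Set.univ = (walkLaw ν n).real (Set.Iio 0) -
      ∑ p ∈ Finset.HasAntidiagonal.antidiagonal n,
        (walkLaw ν p.1).real (Set.Iio 0) * (firstNegLaw ν p.2).real Set.univ := by
  have hc : Set.Ici (0 : ℝ) = (Set.Iio 0)ᶜ := by simp
  have h := wienerHopf_recurrence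
    (charFunRing (Set.Iio 0) measurableSet_Iio fun x hx y hy =>
      Set.mem_Iio.2 (add_neg (Set.mem_Iio.1 hx) (Set.mem_Iio.1 hy)))
    (charFunRing (Set.Ici 0) measurableSet_Ici fun x hx y hy =>
      Set.mem_Ici.2 (add_nonneg (Set.mem_Ici.1 hx) (Set.mem_Ici.1 hy)))
    (fun f hf hf' => charFunsOn.eq_zero measurableSet_Iio hf (hc ▸ hf')) (charFun ν)
    (fun n => charFun ((walkLaw ν n).restrict (Set.Iio 0)))
    -- The logarithmic series starts at n = 1, whereas the unit mass at 0 for n = 0 would contribute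
    -- 1.
    (fun n => if n = 0 then 0 else charFun ((walkLaw ν n).restrict (Set.Ici 0)))
    (fun n => charFun (nonnegLaw ν n)) (fun n => charFun (firstNegLaw ν n))
    (fun n => charFun_restrict_mem_charFunsOn _ measurableSet_Iio)
    (fun n => by
      split_ifs
      · exact zero_mem_charFunsOn
      · exact charFun_restrict_mem_charFunsOn _ measurableSet_Ici)
    (fun n => by
      cases n with
      | zero => exact charFun_mem_charFunsOn (by simp [nonnegLaw])
      | succ n => exact charFun_restrict_mem_charFunsOn _ measurableSet_Ici)
    (fun n => by
      cases n with
      | zero => exact charFun_mem_charFunsOn (by simp [firstNegLaw])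
      | succ n => exact charFun_restrict_mem_charFunsOn _ measurableSet_Iio)
    (by ext; simp [nonnegLaw]) (by ext; simp [firstNegLaw])
    (by
      have : (Measure.dirac (0 : ℝ)).restrict (Set.Iio 0) = 0 := by
        rw [Measure.restrict_eq_zero]; simp
      ext; simp [walkLaw, this])
    (by simp)
    (fun n => by
      rw [nonnegLaw, firstNegLaw, add_comm, hc, charFun_restrict_add_compl _ measurableSet_Iio]
      ext t
      rw [charFun_conv, mul_comm]; rfl)
    (fun n => by
      simp only [Nat.succ_ne_zero, if_false]
      rw [hc, charFun_restrict_add_compl _ measurableSet_Iio, charFun_walkLaw]) n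
  -- At frequency 0 a characteristic function is the total mass.
  have h0 := congrFun h 0
  simp only [Pi.mul_apply, Pi.sub_apply, Finset.sum_apply, Pi.natCast_apply, charFun_zero,
    measureReal_restrict_apply_univ] at h0
  exact_mod_cast h0

end

/-! ### From the recurrence to the exponential formula -/

section

theorem summable_mul_pow_of_norm_le_one {a : ℕ → ℂ} (ha : ∀ n, ‖a n‖ ≤ 1) {z : ℂ} (hz : ‖z‖ < 1) :
    Summable fun n => ‖a n * z ^ n‖ := by
  refine (summable_geometric_of_lt_one (norm_nonneg z) hz).of_nonneg_of_le
    (fun n => norm_nonneg _) fun n => ?_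
  rw [norm_mul, norm_pow]
  exact mul_le_of_le_one_left (by positivity) (ha n)

theorem hasDerivAt_tsum_mul_pow {a : ℕ → ℂ} (ha : ∀ n, ‖a n‖ ≤ 1) {z : ℂ} (hz : ‖z‖ < 1) :
    HasDerivAt (fun z => ∑' n, a n * z ^ n) (∑' n : ℕ, (n + 1) * a (n + 1) * z ^ n) z := by
  -- The differentiated series is dominated uniformly only on a smaller disc.
  obtain ⟨r, hzr, hr⟩ := exists_between hz
  have hr0 : 0 < r := (norm_nonneg z).trans_lt hzr
  have hu : Summable fun n : ℕ => (n : ℝ) * r ^ (n - 1) := by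
    have h := summable_pow_mul_geometric_of_norm_lt_one 1 (r := r)
      (by rwa [Real.norm_eq_abs, abs_of_pos hr0])
    refine (h.mul_left r⁻¹).congr fun n => ?_
    cases n with
    | zero => simp
    | succ n =>
      simp [pow_succ]
      field_simp
  have hb : ∀ (n : ℕ) (y : ℂ), y ∈ Metric.ball (0 : ℂ) r →
      ‖a n * (n * y ^ (n - 1))‖ ≤ n * r ^ (n - 1) := fun n y hy => by
    rw [norm_mul, norm_mul, norm_pow, Complex.norm_natCast]
    refine (mul_le_of_le_one_left (by positivity) (ha n)).trans ?_
    gcongr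
    simpa using (Metric.mem_ball.1 hy).le
  have hzb : z ∈ Metric.ball (0 : ℂ) r := by simpa using hzr
  have h := hasDerivAt_tsum_of_isPreconnected (g := fun n y => a n * y ^ n) hu Metric.isOpen_ball
    (convex_ball _ _).isPreconnected (fun n y _ => (hasDerivAt_pow n y).const_mul (a n)) hb hzb
    (summable_mul_pow_of_norm_le_one ha hz).of_norm hzb
  have hs : Summable fun n : ℕ => a n * (n * z ^ (n - 1)) :=
    (hu.of_nonneg_of_le (fun n => norm_nonneg _) fun n => hb n z hzb).of_norm
  rw [hs.tsum_eq_zero_add] at h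
  convert! h using 1
  simp only [Nat.cast_zero, zero_mul, mul_zero, zero_add, Nat.add_sub_cancel]
  refine tsum_congr fun n => ?_
  push_cast
  ring

/-- The recurrence `n hₙ = pₙ - ∑ pₖ hₙ₋ₖ` says that `1 - ∑ hₙ zⁿ = exp (- ∑ pₙ zⁿ / n)`. -/
theorem one_sub_tsum_eq_exp {p h : ℕ → ℂ} (hp : ∀ n, ‖p n‖ ≤ 1) (hh : ∀ n, ‖h n‖ ≤ 1)
    (hp0 : p 0 = 0) (hh0 : h 0 = 0)
    (hrec : ∀ n : ℕ, (n : ℂ) * h n =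
      p n - ∑ q ∈ Finset.HasAntidiagonal.antidiagonal n, p q.1 * h q.2)
    {z : ℂ} (hz : ‖z‖ < 1) :
    1 - ∑' n, h n * z ^ n = Complex.exp (-∑' n : ℕ, p n / n * z ^ n) := by
  have hq : ∀ n : ℕ, ‖p n / n‖ ≤ 1 := fun n => by
    rcases Nat.eq_zero_or_pos n with rfl | hn
    · simp
    · rw [norm_div, Complex.norm_natCast]
      exact div_le_one_of_le₀ ((hp n).trans (by exact_mod_cast hn)) (Nat.cast_nonneg n)
  -- The recurrence makes the derivative of this product vanish on the unit disc, so it keeps its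
  -- value 1 at the origin.
  set E : ℂ → ℂ := fun z => (1 - ∑' n, h n * z ^ n) * Complex.exp (∑' n : ℕ, p n / n * z ^ n)
    with hE
  have hd : ∀ y ∈ Metric.ball (0 : ℂ) 1, HasDerivAt E 0 y := fun y hy => by
    have hy1 : ‖y‖ < 1 := by simpa using hy
    have h1 := (hasDerivAt_tsum_mul_pow hh hy1).const_sub 1
    have h2 := (hasDerivAt_tsum_mul_pow hq hy1).cexp
    have h3 : ∑' n : ℕ, ((n : ℂ) + 1) * h (n + 1) * y ^ n =
        (∑' n : ℕ, ((n : ℂ) + 1) * (p (n + 1) / ((n + 1 : ℕ) : ℂ)) * y ^ n) *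
          (1 - ∑' n, h n * y ^ n) := by
      have e1 : ∀ n : ℕ, ((n : ℂ) + 1) * (p (n + 1) / ((n + 1 : ℕ) : ℂ)) = p (n + 1) := fun n => by
        have : (n : ℂ) + 1 ≠ 0 := by exact_mod_cast n.succ_ne_zero
        push_cast
        field_simp
      simp only [e1]
      have s1 := summable_mul_pow_of_norm_le_one (fun n => hp (n + 1)) hy1
      have s2 := summable_mul_pow_of_norm_le_one hh hy1
      rw [mul_sub, mul_one, tsum_mul_tsum_eq_tsum_sum_antidiagonal_of_summable_norm s1 s2,
        ← s1.of_norm.tsum_sub (summable_norm_sum_mul_antidiagonal_of_summable_norm s1 s2).of_norm]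
      refine tsum_congr fun n => ?_
      have := hrec (n + 1)
      -- Because `p 0 = 0`, the convolution of length n + 1 becomes that of the shifted `p` with
      -- `h`, of length n.
      rw [Finset.Nat.sum_antidiagonal_succ, hp0, zero_mul, zero_add] at this
      push_cast at this
      rw [this, sub_mul, Finset.sum_mul]
      congr 1
      refine Finset.sum_congr rfl fun q hq => ?_
      rw [← Finset.HasAntidiagonal.mem_antidiagonal.1 hq, pow_add]
      ring
    refine (h1.mul h2).congr_deriv ?_
    rw [h3]
    ring
  have hc := Metric.isOpen_ball.is_const_of_deriv_eq_zero (convex_ball (0 : ℂ) 1).isPreconnected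
    (fun y hy => (hd y hy).differentiableAt.differentiableWithinAt) (fun y hy => (hd y hy).deriv)
    (x := z) (y := 0) (by simpa using hz) (by simp)
  have z0 : ∀ a : ℕ → ℂ, ∑' n, a n * (0 : ℂ) ^ n = a 0 := fun a => by
    rw [tsum_eq_single 0 fun n hn => by simp [hn]]; simp
  simp only [hE, z0, hh0, hp0] at hc
  rw [Complex.exp_neg, ← mul_eq_one_iff_eq_inv₀ (Complex.exp_ne_zero _), hc]
  simp

end

/-! ### The random walk, its laws, and the busy period -/

section

variable {Ω : Type*} [MeasurableSpace Ω] {μ : Measure Ω} [IsProbabilityMeasure μ]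

/-- If `Z` is independent of `Y`, then on an event given by `Y` the law of `ψ(Y) + Z` is the
convolution of the law of `ψ(Y)` with that of `Z`. -/
theorem map_add_restrict_eq_conv {β : Type*} [MeasurableSpace β] {Y : Ω → β} {Z : Ω → ℝ}
    (hY : Measurable Y) (hZ : Measurable Z) (hYZ : IndepFun Y Z μ) {C : Set β}
    (hC : MeasurableSet C) {ψ : β → ℝ} (hψ : Measurable ψ) :
    (μ.restrict (Y ⁻¹' C)).map (fun ω => ψ (Y ω) + Z ω) =
      (μ.restrict (Y ⁻¹' C)).map (fun ω => ψ (Y ω)) ∗ μ.map Z := by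
  have h1 : (μ.restrict (Y ⁻¹' C)).map (fun ω => (Y ω, Z ω)) =
      ((μ.restrict (Y ⁻¹' C)).map Y).prod (μ.map Z) := by
    have h := (indepFun_iff_map_prod_eq_prod_map_map hY.aemeasurable hZ.aemeasurable).1 hYZ
    have hp : Y ⁻¹' C = (fun ω => (Y ω, Z ω)) ⁻¹' (C ×ˢ Set.univ) := by ext; simp
    nth_rewrite 1 [hp]
    rw [← Measure.restrict_map (hY.prodMk hZ) (hC.prod MeasurableSet.univ), h,
      ← Measure.restrict_map hY hC, ← Measure.prod_restrict, Measure.restrict_univ]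
  have : IsProbabilityMeasure (μ.map Z) := Measure.isProbabilityMeasure_map hZ.aemeasurable
  rw [Measure.conv]
  have h2 : (μ.restrict (Y ⁻¹' C)).map (fun ω => ψ (Y ω)) = ((μ.restrict (Y ⁻¹' C)).map Y).map ψ :=
    (Measure.map_map hψ hY).symm
  have h3 := Measure.map_prod_map ((μ.restrict (Y ⁻¹' C)).map Y) (μ.map Z) hψ measurable_id
  rw [Measure.map_id] at h3
  rw [h2, h3, ← h1, Measure.map_map (by fun_prop) (by fun_prop),
    Measure.map_map (by fun_prop) (by fun_prop)]
  rfl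

variable {B A : ℕ → Ω → ℝ}

theorem measurable_walk (hB : ∀ i, Measurable (B i)) (hA : ∀ i, Measurable (A i)) (n : ℕ) :
    Measurable (walk B A n) :=
  Finset.measurable_fun_sum _ fun i _ => (hB i).sub (hA i)

omit [MeasurableSpace Ω] in
theorem walk_succ (n : ℕ) (ω : Ω) :
    walk B A (n + 1) ω = walk B A n ω + (B n ω - A n ω) := Finset.sum_range_succ _ _

/-- The event that the walk is nonnegative up to time `n`. -/
def nonnegEvent (B A : ℕ → Ω → ℝ) (n : ℕ) : Set Ω := {ω | ∀ k ≤ n, 0 ≤ walk B A k ω}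

omit [MeasurableSpace Ω] in
theorem nonnegEvent_succ (n : ℕ) : nonnegEvent B A (n + 1) =
    nonnegEvent B A n ∩ walk B A (n + 1) ⁻¹' Set.Ici 0 := by
  ext ω
  simp only [nonnegEvent, Set.mem_ofPred_eq, Set.mem_inter_iff, Set.mem_preimage, Set.mem_Ici]
  refine ⟨fun h => ⟨fun k hk => h k (by omega), h _ le_rfl⟩, fun h k hk => ?_⟩
  rcases Nat.lt_or_ge k (n + 1) with h' | h'
  · exact h.1 k (by omega)
  · rw [show k = n + 1 by omega]; exact h.2

theorem measurableSet_nonnegEvent (hB : ∀ i, Measurable (B i)) (hA : ∀ i, Measurable (A i)) (n : ℕ) :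
    MeasurableSet (nonnegEvent B A n) := by
  have : nonnegEvent B A n = ⋂ k, ⋂ (_ : k ≤ n), {ω | 0 ≤ walk B A k ω} := by
    ext; simp [nonnegEvent]
  rw [this]
  exact MeasurableSet.iInter fun k => MeasurableSet.iInter fun _ =>
    measurableSet_le measurable_const (measurable_walk hB hA k)

/-- The partial sums of a finite vector. -/
def partialSum (n : ℕ) (y : Finset.range n → ℝ) (k : ℕ) : ℝ :=
  ∑ i ∈ Finset.range k, if h : i ∈ Finset.range n then y ⟨i, h⟩ else 0

theorem measurable_partialSum (n k : ℕ) : Measurable fun y => partialSum n y k := by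
  refine Finset.measurable_fun_sum _ fun i _ => ?_
  split_ifs
  · fun_prop
  · fun_prop

omit [MeasurableSpace Ω] in
theorem partialSum_eq_walk {n k : ℕ} (hk : k ≤ n) (ω : Ω) :
    partialSum n (fun i => B i ω - A i ω) k = walk B A k ω := by
  refine Finset.sum_congr rfl fun i hi => ?_
  rw [dif_pos (Finset.mem_range.2 ((Finset.mem_range.1 hi).trans_le hk))]

variable (hB : ∀ i, Measurable (B i)) (hA : ∀ i, Measurable (A i))
    (hindep : iIndepFun (fun i ω => (B i ω, A i ω)) μ)
    (hident : ∀ i, IdentDistrib (fun ω => (B i ω, A i ω)) (fun ω => (B 0 ω, A 0 ω)) μ μ)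

include hB hA hindep hident in
-- An event of the past up to time n is determined by the first n increments, which are independent
-- of the next one. Taking everything for `C` gives the law of the walk; taking nonnegative paths
-- gives the killed walk.
theorem map_walk_succ_restrict (n : ℕ) (C : Set (ℕ → ℝ)) (hC : MeasurableSet C)
    (hCn : ∀ u v : ℕ → ℝ, (∀ k ≤ n, u k = v k) → u ∈ C → v ∈ C) :
    (μ.restrict {ω | (fun k => walk B A k ω) ∈ C}).map (walk B A (n + 1)) =
      (μ.restrict {ω | (fun k => walk B A k ω) ∈ C}).map (walk B A n) ∗
        μ.map (fun ω => B 0 ω - A 0 ω) := by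
  have hX : iIndepFun (fun i ω => B i ω - A i ω) μ :=
    hindep.comp (fun _ p => p.1 - p.2) fun _ => by fun_prop
  have hXm : ∀ i, Measurable (fun ω => B i ω - A i ω) := fun i => (hB i).sub (hA i)
  have hn : μ.map (fun ω => B n ω - A n ω) = μ.map (fun ω => B 0 ω - A 0 ω) :=
    ((hident n).comp (u := fun p : ℝ × ℝ => p.1 - p.2) (by fun_prop)).map_eq
  have hi : IndepFun (fun ω (i : Finset.range n) => B i ω - A i ω) (fun ω => B n ω - A n ω) μ :=
    (hX.indepFun_finset (Finset.range n) {n} (by simp) hXm).comp measurable_id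
      (measurable_pi_apply (⟨n, by simp⟩ : ({n} : Finset ℕ)))
  have h := map_add_restrict_eq_conv (by fun_prop) (hXm n) hi
    (C := {y | partialSum n y ∈ C}) (measurableSet_preimage
      (measurable_pi_lambda _ fun k => measurable_partialSum n k) hC) (measurable_partialSum n n)
  have hE : (fun ω (i : Finset.range n) => B i ω - A i ω) ⁻¹' {y | partialSum n y ∈ C} =
      {ω | (fun k => walk B A k ω) ∈ C} := by
    ext ω
    exact ⟨hCn _ _ fun k hk => partialSum_eq_walk hk ω,
      hCn _ _ fun k hk => (partialSum_eq_walk hk ω).symm⟩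
  rw [hE, hn] at h
  simp only [partialSum_eq_walk le_rfl] at h
  rw [← h]
  congr 1
  ext ω
  exact walk_succ n ω

include hB hA hindep hident

theorem map_walk (n : ℕ) : μ.map (walk B A n) = walkLaw (μ.map fun ω => B 0 ω - A 0 ω) n := by
  induction n with
  | zero =>
    have : walk B A 0 = fun _ => 0 := by ext; simp [walk]
    rw [this, Measure.map_const, walkLaw]
    simp
  | succ n ih =>
    have := map_walk_succ_restrict hB hA hindep hident n Set.univ .univ (by simp)
    simp only [Set.mem_univ, Set.ofPred_true, Measure.restrict_univ] at this
    rw [this, ih, walkLaw]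

theorem map_walk_succ_restrict_nonnegEvent (n : ℕ) :
    (μ.restrict (nonnegEvent B A n)).map (walk B A (n + 1)) =
      (μ.restrict (nonnegEvent B A n)).map (walk B A n) ∗ μ.map (fun ω => B 0 ω - A 0 ω) := by
  refine map_walk_succ_restrict hB hA hindep hident n {u | ∀ k ≤ n, 0 ≤ u k} ?_ ?_
  · have : {u : ℕ → ℝ | ∀ k ≤ n, 0 ≤ u k} = ⋂ k, ⋂ (_ : k ≤ n), {u | 0 ≤ u k} := by ext; simp
    rw [this]
    exact MeasurableSet.iInter fun k => MeasurableSet.iInter fun _ =>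
      measurableSet_le measurable_const (measurable_pi_apply k)
  · intro u v h hu k hk
    rw [← h k hk]
    exact hu k hk

theorem map_walk_restrict_nonnegEvent (n : ℕ) :
    (μ.restrict (nonnegEvent B A n)).map (walk B A n) =
      nonnegLaw (μ.map fun ω => B 0 ω - A 0 ω) n := by
  induction n with
  | zero =>
    have h0 : walk B A 0 = fun _ => 0 := by ext; simp [walk]
    have h1 : nonnegEvent B A 0 = Set.univ := by ext; simp [nonnegEvent, walk]
    rw [h0, h1, Measure.restrict_univ, Measure.map_const, nonnegLaw]
    simp
  | succ n ih =>
    rw [nonnegEvent_succ, nonnegLaw, ← ih,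
      ← map_walk_succ_restrict_nonnegEvent hB hA hindep hident,
      Measure.restrict_map (measurable_walk hB hA _) measurableSet_Ici,
      Measure.restrict_restrict (measurable_walk hB hA _ measurableSet_Ici), Set.inter_comm]

omit [MeasurableSpace Ω] [IsProbabilityMeasure μ] hB hA hindep hident in
theorem numServed_eq_natCast_iff (n : ℕ) (ω : Ω) :
    numServed B A ω = n ↔ walk B A n ω < 0 ∧ ∀ k < n, 0 ≤ walk B A k ω := by
  constructor
  · intro h
    rw [numServed] at h
    constructor
    · have hne : {m : ℕ∞ | ∃ n : ℕ, m = (n : ℕ∞) ∧ walk B A n ω < 0}.Nonempty := by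
        by_contra hne
        rw [Set.not_nonempty_iff_eq_empty.1 hne, sInf_empty] at h
        exact ENat.natCast_ne_top n h.symm
      obtain ⟨k, hk, hk'⟩ := csInf_mem hne
      rw [h, Nat.cast_inj] at hk
      rwa [hk]
    · intro k hk
      by_contra! hneg
      have : sInf {m : ℕ∞ | ∃ n : ℕ, m = (n : ℕ∞) ∧ walk B A n ω < 0} ≤ k :=
        sInf_le ⟨k, rfl, hneg⟩
      rw [h, Nat.cast_le] at this
      omega
  · rintro ⟨h1, h2⟩
    refine le_antisymm (sInf_le ⟨n, rfl, h1⟩) (le_sInf ?_)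
    rintro _ ⟨k, rfl, hk⟩
    rw [Nat.cast_le]
    by_contra! hlt
    exact absurd (h2 k hlt) (not_le.2 hk)

omit [MeasurableSpace Ω] [IsProbabilityMeasure μ] hB hA hindep hident in
theorem setOf_numServed_eq_succ (n : ℕ) : {ω | numServed B A ω = (n + 1 : ℕ)} =
    walk B A (n + 1) ⁻¹' Set.Iio 0 ∩ nonnegEvent B A n := by
  ext ω
  rw [Set.mem_ofPred_eq, numServed_eq_natCast_iff]
  simp [nonnegEvent]

omit [MeasurableSpace Ω] [IsProbabilityMeasure μ] hB hA hindep hident in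
theorem setOf_numServed_eq_zero : {ω | numServed B A ω = (0 : ℕ)} = ∅ := by
  ext ω
  rw [Set.mem_ofPred_eq, numServed_eq_natCast_iff]
  simp [walk]

theorem measure_numServed_eq (n : ℕ) : μ {ω | numServed B A ω = n} =
    firstNegLaw (μ.map fun ω => B 0 ω - A 0 ω) n Set.univ := by
  cases n with
  | zero => rw [setOf_numServed_eq_zero, firstNegLaw]; simp
  | succ n =>
    rw [setOf_numServed_eq_succ, firstNegLaw, ← map_walk_restrict_nonnegEvent hB hA hindep hident,
      ← map_walk_succ_restrict_nonnegEvent hB hA hindep hident, Measure.restrict_apply_univ,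
      Measure.map_apply (measurable_walk hB hA _) measurableSet_Iio,
      Measure.restrict_apply (measurable_walk hB hA _ measurableSet_Iio)]

omit hindep hident [IsProbabilityMeasure μ] in
theorem measurableSet_numServed_eq (n : ℕ) : MeasurableSet {ω | numServed B A ω = n} := by
  cases n with
  | zero => rw [setOf_numServed_eq_zero]; exact MeasurableSet.empty
  | succ n =>
    rw [setOf_numServed_eq_succ]
    exact (measurable_walk hB hA _ measurableSet_Iio).inter (measurableSet_nonnegEvent hB hA n)

omit hindep hident in
theorem genFun_numServed {z : ℂ} (hz : ‖z‖ < 1) : genFun μ (numServed B A) z =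
    ∑' n : ℕ, (μ.real {ω | numServed B A ω = n} : ℂ) * z ^ n := by
  -- The integrand is the sum of these indicators; where `N = ⊤` they all vanish, in accordance with
  -- z^∞ = 0.
  have hint : ∀ n : ℕ, Integrable ({ω | numServed B A ω = n}.indicator fun _ => z ^ n) μ :=
    fun n => (integrable_const _).indicator (measurableSet_numServed_eq hB hA n)
  have h := hasSum_integral_of_summable_integral_norm hint (by
    refine (summable_geometric_of_lt_one (norm_nonneg z) hz).of_nonneg_of_le
      (fun n => integral_nonneg fun _ => norm_nonneg _) fun n => ?_
    simp only [norm_indicator_eq_indicator_norm, norm_pow]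
    rw [integral_indicator_const _ (measurableSet_numServed_eq hB hA n)]
    exact mul_le_of_le_one_left (by positivity) measureReal_le_one)
  simp only [integral_indicator_const _ (measurableSet_numServed_eq hB hA _),
    Complex.real_smul] at h
  rw [h.tsum_eq, genFun]
  congr 1
  ext ω
  cases hN : numServed B A ω with
  | top => simp [hN]
  | coe m =>
    rw [tsum_eq_single m fun n hn => Set.indicator_of_notMem (fun h => hn ?_) _,
      Set.indicator_of_mem (by exact hN)]
    · simp
    · rw [Set.mem_ofPred_eq, hN, Nat.cast_inj] at h
      exact h.symm

/-- The identity of Sparre Andersen. -/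
theorem one_sub_genFun_numServed {z : ℂ} (hz : ‖z‖ < 1) : 1 - genFun μ (numServed B A) z =
    Complex.exp (-∑' n : ℕ, (μ.real {ω | walk B A n ω < 0} : ℂ) / n * z ^ n) := by
  have : IsProbabilityMeasure (μ.map fun ω => B 0 ω - A 0 ω) :=
    Measure.isProbabilityMeasure_map ((hB 0).sub (hA 0)).aemeasurable
  have hw : ∀ n, (walkLaw (μ.map fun ω => B 0 ω - A 0 ω) n).real (Set.Iio 0) =
      μ.real {ω | walk B A n ω < 0} := fun n => by
    rw [← map_walk hB hA hindep hident, map_measureReal_apply (measurable_walk hB hA n)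
      measurableSet_Iio]
    rfl
  have hN : ∀ n, (firstNegLaw (μ.map fun ω => B 0 ω - A 0 ω) n).real Set.univ =
      μ.real {ω | numServed B A ω = n} := fun n => by
    rw [measureReal_def, measureReal_def, measure_numServed_eq hB hA hindep hident]
  have hb : ∀ s : Set Ω, ‖(μ.real s : ℂ)‖ ≤ 1 := fun s => by
    rw [Complex.norm_real, Real.norm_of_nonneg measureReal_nonneg]
    exact measureReal_le_one
  rw [genFun_numServed hB hA hz]
  refine one_sub_tsum_eq_exp (fun n => hb _) (fun n => hb _) (by simp [walk]) ?_ (fun n => ?_) hz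
  · rw [setOf_numServed_eq_zero]; simp
  · have := natCast_mul_firstNegLaw (μ.map fun ω => B 0 ω - A 0 ω) n
    simp only [hw, hN] at this
    exact_mod_cast this

end

/-! ### The density as a series of characteristic functions: its mean and its principal value -/

section

/-- Both arguments lie within π/2 of 0, so their difference stays in the principal strip. -/
theorem log_div_of_re_pos {a b : ℂ} (ha : 0 < a.re) (hb : 0 < b.re) :
    Complex.log (a / b) = Complex.log a - Complex.log b := by
  have ha0 : a ≠ 0 := fun h => by simp [h] at ha
  have hb0 : b ≠ 0 := fun h => by simp [h] at hb
  have h1 := abs_lt.1 (Complex.abs_arg_lt_pi_div_two_iff.2 (Or.inl ha))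
  have h2 := abs_lt.1 (Complex.abs_arg_lt_pi_div_two_iff.2 (Or.inl hb))
  rw [← Complex.log_exp (x := Complex.log a - Complex.log b), Complex.exp_sub, Complex.exp_log ha0,
    Complex.exp_log hb0]
  · rw [Complex.sub_im, Complex.log_im, Complex.log_im]; linarith
  · rw [Complex.sub_im, Complex.log_im, Complex.log_im]; linarith

theorem re_one_sub_pos {w : ℂ} (hw : ‖w‖ < 1) : 0 < (1 - w).re := by
  have := Complex.re_le_norm w
  rw [Complex.sub_re, Complex.one_re]
  linarith

/-- This is the difference of two Taylor series of -log(1 - ·). The term n = 0 is harmless, since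
division by 0 gives 0. -/
theorem hasSum_log_one_sub_div {z w : ℂ} (hz : ‖z‖ < 1) (hw : ‖w‖ ≤ 1) :
    HasSum (fun n : ℕ => z ^ n / n * (1 - w ^ n)) (Complex.log ((1 - z * w) / (1 - z))) := by
  have hzw : ‖z * w‖ < 1 := by
    rw [norm_mul]
    exact (mul_le_of_le_one_right (norm_nonneg _) hw).trans_lt hz
  rw [log_div_of_re_pos (re_one_sub_pos hzw) (re_one_sub_pos hz)]
  convert! (Complex.hasSum_taylorSeries_neg_log hz).sub (Complex.hasSum_taylorSeries_neg_log hzw)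
    using 1
  · ext n; rw [mul_pow]; ring
  · ring

variable {σ : ℕ → Measure ℝ} [hσ : ∀ n, IsProbabilityMeasure (σ n)] {c : ℕ → ℂ}

/-- Dominated convergence, termwise and under the integral sign. -/
theorem tendsto_tsum_mul_integral {l : Filter ℝ} [l.IsCountablyGenerated] (hc : Summable fun n => ‖c n‖)
    {u : ℝ → ℝ → ℝ} {v : ℝ → ℝ} {b : ℝ} (hu : ∀ t, Measurable (u t)) (hub : ∀ t x, |u t x| ≤ b)
    (huv : ∀ x, Tendsto (fun t => u t x) l (𝓝 (v x))) :
    Tendsto (fun t => ∑' n, c n * ((∫ x, u t x ∂σ n : ℝ) : ℂ)) l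
      (𝓝 (∑' n, c n * ((∫ x, v x ∂σ n : ℝ) : ℂ))) := by
  refine tendsto_tsum_of_dominated_convergence (hc.mul_right b) (fun n => ?_)
    (Eventually.of_forall fun t n => ?_)
  · refine Tendsto.const_mul _ ((Complex.continuous_ofReal.tendsto _).comp ?_)
    exact tendsto_integral_filter_of_dominated_convergence (fun _ => b)
      (Eventually.of_forall fun t => (hu t).aestronglyMeasurable)
      (Eventually.of_forall fun t => Eventually.of_forall fun x => hub t x)
      (integrable_const b) (Eventually.of_forall huv)
  · rw [norm_mul, Complex.norm_real]
    gcongr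
    have := norm_integral_le_of_norm_le_const (μ := σ n) (f := u t)
      (Eventually.of_forall fun x => hub t x)
    simpa using this

theorem continuous_charFun_real (ν : Measure ℝ) [IsFiniteMeasure ν] : Continuous (charFun ν) := by
  simp only [funext charFun_apply_real]
  refine continuous_of_dominated (bound := fun _ => 1) (fun t => by fun_prop)
    (fun t => Eventually.of_forall fun x => ?_) (integrable_const _)
    (Eventually.of_forall fun x => by fun_prop)
  rw [← Complex.ofReal_mul, Complex.norm_exp_ofReal_mul_I]

/-- The superposition `∑ cₙ (1 - E exp(-i θ Xₙ))`. -/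
def charSeries (σ : ℕ → Measure ℝ) (c : ℕ → ℂ) (θ : ℝ) : ℂ := ∑' n, c n * (1 - charFun (σ n) (-θ))

theorem norm_charSeries_term_le (n : ℕ) (θ : ℝ) :
    ‖c n * (1 - charFun (σ n) (-θ))‖ ≤ ‖c n‖ * 2 := by
  rw [norm_mul]
  gcongr
  exact norm_one_sub_charFun_le_two

theorem continuous_charSeries (hc : Summable fun n => ‖c n‖) : Continuous (charSeries σ c) := by
  refine continuous_tsum (fun n => ?_) (hc.mul_right 2) norm_charSeries_term_le
  exact continuous_const.mul (continuous_const.sub ((continuous_charFun_real _).comp continuous_neg))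

theorem hasSum_charSeries (hc : Summable fun n => ‖c n‖) (θ : ℝ) :
    HasSum (fun n => c n * (1 - charFun (σ n) (-θ))) (charSeries σ c θ) :=
  ((hc.mul_right 2).of_norm_bounded fun n => norm_charSeries_term_le n θ).hasSum

theorem hasSum_integral_charSeries (hc : Summable fun n => ‖c n‖) {T : ℝ} (hT : 0 < T) :
    HasSum (fun n => c n * (2 * T * (1 - ((∫ x, Real.sinc (T * x) ∂σ n : ℝ) : ℂ))))
      (∫ θ in (-T)..T, charSeries σ c θ) := by
  have h := intervalIntegral.hasSum_integral_of_dominated_convergence (a := -T) (b := T)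
    (μ := volume) (F := fun n θ => c n * (1 - charFun (σ n) (-θ))) (f := charSeries σ c)
    (fun n _ => ‖c n‖ * 2) (fun n => Continuous.aestronglyMeasurable (continuous_const.mul
      (continuous_const.sub ((continuous_charFun_real _).comp continuous_neg))))
    (fun n => Eventually.of_forall fun θ _ => norm_charSeries_term_le n θ)
    (Eventually.of_forall fun _ _ => hc.mul_right 2) intervalIntegrable_const
    (Eventually.of_forall fun θ _ => hasSum_charSeries hc θ)
  have e : ∀ n, ∫ θ in (-T)..T, c n * (1 - charFun (σ n) (-θ)) =
      c n * (2 * T * (1 - ((∫ x, Real.sinc (T * x) ∂σ n : ℝ) : ℂ))) := fun n => by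
    have h1 := intervalIntegral.integral_comp_neg (a := -T) (b := T) (charFun (σ n))
    rw [neg_neg, integral_charFun_Icc hT] at h1
    have h2 : IntervalIntegrable (fun θ => charFun (σ n) (-θ)) volume (-T) T :=
      ((continuous_charFun_real _).comp continuous_neg).intervalIntegrable _ _
    rw [intervalIntegral.integral_const_mul, intervalIntegral.integral_sub intervalIntegrable_const
      h2, h1,
      intervalIntegral.integral_const, Complex.real_smul]
    push_cast
    ring
  simpa only [e] using h

theorem integral_indicator_one_const {ν : Measure ℝ} {s : Set ℝ} (hs : MeasurableSet s) :
    ∫ x, s.indicator (fun _ => (1 : ℝ)) x ∂ν = ν.real s := by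
  rw [integral_indicator_const _ hs, smul_eq_mul, mul_one]

theorem tendsto_sinc_mul (x : ℝ) : Tendsto (fun t => Real.sinc (t * x)) atTop
    (𝓝 (({0} : Set ℝ).indicator (fun _ => (1 : ℝ)) x)) := by
  by_cases hx : x = 0
  · simp [hx]
  · rw [Set.indicator_of_notMem (by simpa using hx)]
    have h : Tendsto (fun t : ℝ => |t * x|⁻¹) atTop (𝓝 0) := by
      simp only [abs_mul]
      exact ((tendsto_abs_atTop_atTop).atTop_mul_const (abs_pos.2 hx)).inv_tendsto_atTop
    refine squeeze_zero_norm' ?_ h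
    filter_upwards [eventually_gt_atTop 0] with t ht
    rw [Real.sinc_of_ne_zero (mul_ne_zero ht.ne' hx), norm_div, Real.norm_eq_abs, Real.norm_eq_abs,
      div_eq_mul_inv]
    exact mul_le_of_le_one_left (by positivity) (Real.abs_sin_le_one _)

/-- The mean of exp(-iθx) over [-T, T] is sinc(Tx), which in the limit detects exactly x = 0. So
only atoms at 0 lower the value at infinity. -/
theorem tendsto_mean_charSeries (hc : Summable fun n => ‖c n‖) :
    Tendsto (fun T : ℝ => ((2 * T : ℝ) : ℂ)⁻¹ * ∫ θ in (-T)..T, charSeries σ c θ) atTop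
      (𝓝 (∑' n, c n * ((1 - (σ n).real {0} : ℝ) : ℂ))) := by
  have h := tendsto_tsum_mul_integral (σ := σ) (l := atTop) hc
    (u := fun t x => 1 - Real.sinc (t * x))
    (v := fun x => 1 - ({0} : Set ℝ).indicator (fun _ => (1 : ℝ)) x) (b := 2)
    (fun t => by fun_prop)
    (fun t x => by
      have h1 := Real.sinc_le_one (t * x)
      have h2 := Real.neg_one_le_sinc (t * x)
      rw [abs_le]; constructor <;> linarith)
    (fun x => (tendsto_sinc_mul x).const_sub 1)
  have e : ∀ n, ∫ x, (1 - ({0} : Set ℝ).indicator (fun _ => (1 : ℝ)) x) ∂σ n =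
      1 - (σ n).real {0} := fun n => by
    rw [integral_sub (integrable_const _)
      ((integrable_const _).indicator (measurableSet_singleton _)),
      integral_indicator_one_const (measurableSet_singleton _)]
    simp
  simp only [e] at h
  refine h.congr' ?_
  filter_upwards [eventually_gt_atTop 0] with T hT
  have hT' : (T : ℂ) ≠ 0 := by exact_mod_cast hT.ne'
  have hi : ∀ n, Integrable (fun x => Real.sinc (T * x)) (σ n) := fun n =>
    (integrable_const (1 : ℝ)).mono' (by fun_prop)
      (Eventually.of_forall fun x => Real.abs_sinc_le_one _)
  rw [← (hasSum_integral_charSeries hc hT).tsum_eq, ← tsum_mul_left]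
  refine tsum_congr fun n => ?_
  rw [integral_sub (integrable_const _) (hi n)]
  simp only [integral_const, probReal_univ, smul_eq_mul]
  push_cast
  field_simp

/-- The mean of the sine integral of `t Xₙ`, summed with the weights `cₙ`. -/
def sineSeries (σ : ℕ → Measure ℝ) (c : ℕ → ℂ) (t : ℝ) : ℂ :=
  ∑' n, c n * ((∫ x, sineIntegral (t * x) ∂σ n : ℝ) : ℂ)

theorem integral_sin_mul_div (x ε T : ℝ) (hε : 0 < ε) (hT : ε < T) :
    ∫ θ in ε..T, Real.sin (θ * x) / θ = sineIntegral (T * x) - sineIntegral (ε * x) := by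
  have h1 : ∫ θ in ε..T, Real.sin (θ * x) / θ = x * ∫ θ in ε..T, Real.sinc (θ * x) := by
    rw [← intervalIntegral.integral_const_mul]
    refine intervalIntegral.integral_congr fun θ hθ => ?_
    rw [Set.uIcc_of_le hT.le] at hθ
    have hθ0 : θ ≠ 0 := (hε.trans_le hθ.1).ne'
    by_cases hx : x = 0
    · simp [hx]
    · simp only [Real.sinc_of_ne_zero (mul_ne_zero hθ0 hx)]
      field_simp
  rw [h1, intervalIntegral.mul_integral_comp_mul_right, sineIntegral, sineIntegral,
    intervalIntegral.integral_interval_sub_left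
      (Real.continuous_sinc.intervalIntegrable _ _) (Real.continuous_sinc.intervalIntegrable _ _)]

theorem charFun_sub_charFun_neg_div {ν : Measure ℝ} [IsProbabilityMeasure ν] (θ : ℝ) :
    (charFun ν θ - charFun ν (-θ)) / θ =
      2 * Complex.I * ((∫ x, Real.sin (θ * x) / θ ∂ν : ℝ) : ℂ) := by
  have hi : ∀ t : ℝ, Integrable (fun x : ℝ => Complex.exp (t * x * Complex.I)) ν := fun t => by
    refine (integrable_const (1 : ℝ)).mono' (by fun_prop) (Eventually.of_forall fun x => ?_)
    rw [← Complex.ofReal_mul, Complex.norm_exp_ofReal_mul_I]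
  rw [charFun_apply_real, charFun_apply_real, ← integral_sub (hi _) (hi _), ← integral_div,
    ← integral_complex_ofReal, ← integral_const_mul]
  refine integral_congr_ae (Eventually.of_forall fun x => ?_)
  simp only [Complex.ofReal_div, Complex.ofReal_sin, Complex.sin, Complex.ofReal_mul,
    Complex.ofReal_neg, neg_mul]
  linear_combination (-(Complex.exp (-(θ * x * Complex.I)) - Complex.exp (θ * x * Complex.I)) / θ) *
    Complex.I_sq

/-- Away from 0 the kernel sin(θx)/θ is bounded by 1/ε, so Fubini applies without any moment of `ν`.
-/
theorem integral_charFun_sub_div {ν : Measure ℝ} [IsProbabilityMeasure ν] {ε T : ℝ} (hε : 0 < ε)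
    (hT : ε < T) : ∫ θ in ε..T, (charFun ν θ - charFun ν (-θ)) / θ =
      2 * Complex.I *
        ((∫ x, sineIntegral (T * x) ∂ν) - (∫ x, sineIntegral (ε * x) ∂ν) : ℝ) := by
  have hi : ∀ t, Integrable (fun x => sineIntegral (t * x)) ν := fun t =>
    (integrable_const (4 : ℝ)).mono'
      (continuous_sineIntegral.comp (by fun_prop)).aestronglyMeasurable
      (Eventually.of_forall fun x => abs_sineIntegral_le _)
  simp only [charFun_sub_charFun_neg_div]
  rw [intervalIntegral.integral_const_mul, intervalIntegral.integral_ofReal,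
    ← integral_sub (hi _) (hi _), intervalIntegral_integral_swap]
  · simp only [integral_sin_mul_div _ _ _ hε hT]
  · rw [Set.uIoc_of_le hT.le]
    refine (integrable_const (ε⁻¹ : ℝ)).mono' (Measurable.aestronglyMeasurable ?_) ?_
    · exact (Real.measurable_sin.comp (by fun_prop)).div measurable_fst
    · rw [← Measure.restrict_univ (μ := ν), Measure.prod_restrict]
      refine (ae_restrict_iff' (measurableSet_Ioc.prod .univ)).2 (Eventually.of_forall fun p hp => ?_)
      have hp1 : ε < p.1 := hp.1.1
      rw [Function.uncurry, norm_div, Real.norm_eq_abs, Real.norm_eq_abs,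
        abs_of_pos (hε.trans hp1), div_eq_mul_inv]
      refine (mul_le_of_le_one_left (by have := hε.trans hp1; positivity)
        (Real.abs_sin_le_one _)).trans ?_
      gcongr

theorem integral_abs_le_and_lt_abs {f : ℝ → ℂ} (hf : ContinuousOn f {0}ᶜ) {ε T : ℝ} (hε : 0 < ε)
    (hT : ε < T) : ∫ θ in {θ : ℝ | |θ| ≤ T ∧ ε < |θ|}, f θ = ∫ θ in ε..T, (f θ + f (-θ)) := by
  have hset : {θ : ℝ | |θ| ≤ T ∧ ε < |θ|} = Set.Ioc ε T ∪ Set.Ico (-T) (-ε) := by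
    ext θ
    simp only [Set.mem_ofPred_eq, Set.mem_union, Set.mem_Ioc, Set.mem_Ico]
    rcases le_total 0 θ with h | h
    · rw [abs_of_nonneg h]
      constructor
      · rintro ⟨h1, h2⟩; exact Or.inl ⟨h2, h1⟩
      · rintro (h' | h')
        · exact ⟨h'.2, h'.1⟩
        · linarith [h'.2]
    · rw [abs_of_nonpos h]
      constructor
      · rintro ⟨h1, h2⟩; exact Or.inr ⟨by linarith, by linarith⟩
      · rintro (h' | h')
        · linarith [h'.1]
        · exact ⟨by linarith [h'.1], by linarith [h'.2]⟩
  have h1 : IntegrableOn f (Set.Icc ε T) :=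
    (hf.mono fun θ hθ => (hε.trans_le hθ.1).ne').integrableOn_Icc
  have h2 : IntegrableOn f (Set.Icc (-T) (-ε)) :=
    (hf.mono fun θ hθ => (by linarith [hθ.2] : θ < 0).ne).integrableOn_Icc
  have i1 : IntervalIntegrable f volume ε T :=
    (intervalIntegrable_iff_integrableOn_Icc_of_le hT.le).2 h1
  have i2 : IntervalIntegrable (fun θ => f (-θ)) volume ε T := by
    have : IntervalIntegrable f volume (-T) (-ε) :=
      (intervalIntegrable_iff_integrableOn_Icc_of_le (by linarith)).2 h2
    simpa using ((IntervalIntegrable.iff_comp_neg (by simp)).1 this).symm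
  rw [hset, setIntegral_union (Set.disjoint_left.2 fun θ h h' => by
      have := h.1; have := h'.2; linarith) measurableSet_Ico
      (h1.mono_set Set.Ioc_subset_Icc_self) (h2.mono_set Set.Ico_subset_Icc_self),
    intervalIntegral.integral_add i1 i2, intervalIntegral.integral_comp_neg,
    intervalIntegral.integral_of_le hT.le, intervalIntegral.integral_of_le (by linarith),
    integral_Ico_eq_integral_Ioc]

/-- Folding θ and -θ together cancels the even part, the constant 1 included, and leaves sines only.
-/
theorem integral_charSeries_div (hc : Summable fun n => ‖c n‖) {ε T : ℝ} (hε : 0 < ε)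
    (hT : ε < T) : ∫ θ in {θ : ℝ | |θ| ≤ T ∧ ε < |θ|}, charSeries σ c θ / θ =
      2 * Complex.I * (sineSeries σ c T - sineSeries σ c ε) := by
  have hf : ContinuousOn (fun θ : ℝ => charSeries σ c θ / θ) {0}ᶜ :=
    (continuous_charSeries hc).continuousOn.div Complex.continuous_ofReal.continuousOn
      fun θ hθ => by exact_mod_cast hθ
  rw [integral_abs_le_and_lt_abs hf hε hT]
  have hcont : ∀ n, Continuous fun θ => charFun (σ n) θ - charFun (σ n) (-θ) := fun n =>
    (continuous_charFun_real _).sub ((continuous_charFun_real _).comp continuous_neg)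
  have hpos : ∀ θ ∈ Set.uIoc ε T, ε < θ := fun θ hθ => by
    rw [Set.uIoc_of_le hT.le] at hθ
    exact hθ.1
  have h := intervalIntegral.hasSum_integral_of_dominated_convergence (a := ε) (b := T)
    (μ := volume) (F := fun n θ => c n * ((charFun (σ n) θ - charFun (σ n) (-θ)) / θ))
    (f := fun θ => charSeries σ c θ / θ + charSeries σ c (-θ) / (-θ : ℝ))
    (fun n _ => ‖c n‖ * (2 / ε)) (fun n => Measurable.aestronglyMeasurable
      (((hcont n).measurable.div Complex.measurable_ofReal).const_mul _))
    (fun n => Eventually.of_forall fun θ hθ => ?_)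
    (Eventually.of_forall fun _ _ => hc.mul_right _) intervalIntegrable_const
    (Eventually.of_forall fun θ hθ => ?_)
  · rw [← h.tsum_eq, sineSeries, sineSeries]
    have hb : ∀ t n, ‖c n * ((∫ x, sineIntegral (t * x) ∂σ n : ℝ) : ℂ)‖ ≤ ‖c n‖ * 4 := fun t n => by
      rw [norm_mul, Complex.norm_real]
      gcongr
      have := norm_integral_le_of_norm_le_const (μ := σ n) (f := fun x => sineIntegral (t * x))
        (Eventually.of_forall fun x => abs_sineIntegral_le _)
      simpa using this
    rw [← ((hc.mul_right 4).of_norm_bounded (hb T)).tsum_sub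
      ((hc.mul_right 4).of_norm_bounded (hb ε)), ← tsum_mul_left]
    refine tsum_congr fun n => ?_
    rw [intervalIntegral.integral_const_mul, integral_charFun_sub_div hε hT]
    push_cast
    ring
  · have h0 := hpos θ hθ
    rw [norm_mul, norm_div, Complex.norm_real, Real.norm_of_nonneg (hε.trans h0).le]
    have h2 : ‖charFun (σ n) θ - charFun (σ n) (-θ)‖ ≤ 2 := by
      refine (norm_sub_le _ _).trans ?_
      linarith [norm_charFun_le_one (μ := σ n) θ, norm_charFun_le_one (μ := σ n) (-θ)]
    gcongr
  · have h1 := (hasSum_charSeries (σ := σ) hc θ).div_const (θ : ℂ)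
    have h2 := (hasSum_charSeries (σ := σ) hc (-θ)).div_const ((-θ : ℝ) : ℂ)
    convert! h1.add h2 using 1
    ext n
    push_cast
    rw [neg_neg, div_neg]
    ring

theorem tendsto_sineSeries_zero (hc : Summable fun n => ‖c n‖) :
    Tendsto (sineSeries σ c) (𝓝[>] 0) (𝓝 0) := by
  have h := tendsto_tsum_mul_integral (σ := σ) (l := 𝓝[>] (0 : ℝ)) hc
    (u := fun t x => sineIntegral (t * x)) (v := fun _ => 0) (b := 4)
    (fun t => continuous_sineIntegral.measurable.comp (by fun_prop))
    (fun t x => abs_sineIntegral_le _) (fun x => ?_)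
  · simp only [integral_zero, Complex.ofReal_zero, mul_zero, tsum_zero] at h
    exact h
  · have : Continuous fun t => sineIntegral (t * x) := continuous_sineIntegral.comp (by fun_prop)
    have := (this.tendsto 0).mono_left (nhdsWithin_le_nhds (s := Set.Ioi 0))
    simpa [sineIntegral_zero] using this

/-- The limit is (π/2) sgn x; the sign is written with indicators so that its mean is read off from
P(X = 0) and P(X < 0). -/
theorem tendsto_sineIntegral_mul (x : ℝ) : Tendsto (fun t => sineIntegral (t * x)) atTop
    (𝓝 (Real.pi / 2 * (1 - ({0} : Set ℝ).indicator (fun _ => (1 : ℝ)) x -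
      2 * (Set.Iio 0).indicator (fun _ => (1 : ℝ)) x))) := by
  rcases lt_trichotomy x 0 with hx | rfl | hx
  · have h := (tendsto_sineIntegral.comp
      (tendsto_id.atTop_mul_const (neg_pos.2 hx))).neg
    rw [Set.indicator_of_notMem (by simpa using hx.ne), Set.indicator_of_mem (by simpa using hx)]
    convert! h using 1
    · ext t
      simp [sineIntegral_neg]
    · congr 1
      ring
  · simp [sineIntegral_zero]
  · rw [Set.indicator_of_notMem (by simpa using hx.ne'),
      Set.indicator_of_notMem (by simpa using hx.le)]
    convert! tendsto_sineIntegral.comp (tendsto_id.atTop_mul_const hx) using 1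
    simp

theorem tendsto_sineSeries_atTop (hc : Summable fun n => ‖c n‖) :
    Tendsto (sineSeries σ c) atTop (𝓝 (∑' n, c n *
      ((Real.pi / 2 * (1 - (σ n).real {0} - 2 * (σ n).real (Set.Iio 0)) : ℝ) : ℂ))) := by
  have h := tendsto_tsum_mul_integral (σ := σ) (l := atTop) hc
    (u := fun t x => sineIntegral (t * x)) (b := 4)
    (fun t => continuous_sineIntegral.measurable.comp (by fun_prop))
    (fun t x => abs_sineIntegral_le _) tendsto_sineIntegral_mul
  have i0 : ∀ n, Integrable (({0} : Set ℝ).indicator (fun _ => (1 : ℝ))) (σ n) := fun n =>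
    (integrable_const _).indicator (measurableSet_singleton _)
  have i1 : ∀ n, Integrable ((Set.Iio (0 : ℝ)).indicator (fun _ => (1 : ℝ))) (σ n) := fun n =>
    (integrable_const _).indicator measurableSet_Iio
  have e : ∀ n, ∫ x, Real.pi / 2 * (1 - ({0} : Set ℝ).indicator (fun _ => (1 : ℝ)) x -
      2 * (Set.Iio 0).indicator (fun _ => (1 : ℝ)) x) ∂σ n =
      Real.pi / 2 * (1 - (σ n).real {0} - 2 * (σ n).real (Set.Iio 0)) := fun n => by
    have i2 : Integrable (fun x => 1 - ({0} : Set ℝ).indicator (fun _ => (1 : ℝ)) x) (σ n) :=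
      (integrable_const _).sub (i0 n)
    rw [integral_const_mul, integral_sub i2 ((i1 n).const_mul 2),
      integral_sub (integrable_const _) (i0 n), integral_const_mul,
      integral_indicator_one_const (measurableSet_singleton _),
      integral_indicator_one_const measurableSet_Iio]
    simp
  simp only [e] at h
  exact h

end

/-! ### Assembling the Cauchy integral and the generating function -/

theorem hasDoublePV_charSeries {σ : ℕ → Measure ℝ} [∀ n, IsProbabilityMeasure (σ n)] {c : ℕ → ℂ}
    (hc : Summable fun n => ‖c n‖) {φ : ℂ → ℂ}
    (hφ : ∀ θ : ℝ, φ ((θ : ℂ) * Complex.I) = charSeries σ c θ) :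
    HasDoublePV φ 0 (2 * Complex.I * ∑' n, c n *
      ((Real.pi / 2 * (1 - (σ n).real {0} - 2 * (σ n).real (Set.Iio 0)) : ℝ) : ℂ)) := by
  refine ⟨fun T => 2 * Complex.I * sineSeries σ c T, fun T hT => ?_,
    (tendsto_sineSeries_atTop hc).const_mul _⟩
  rw [norm_zero] at hT
  have h := ((tendsto_sineSeries_zero (σ := σ) hc).const_sub (sineSeries σ c T)).const_mul
    (2 * Complex.I)
  rw [sub_zero] at h
  refine h.congr' ?_
  filter_upwards [self_mem_nhdsWithin, nhdsWithin_le_nhds (eventually_lt_nhds hT)] with ε hε hεT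
  rw [← integral_charSeries_div hc hε hεT, truncatedCauchy]
  simp only [sub_zero, norm_mul, Complex.norm_I, mul_one, Complex.norm_real, Real.norm_eq_abs, hφ]
  congr 1
  ext θ
  have := Complex.I_ne_zero
  by_cases hθ : (θ : ℂ) = 0
  · simp [hθ]
  · field_simp

theorem jointLST_mul_I {Ω : Type*} [MeasurableSpace Ω] {μ : Measure Ω} {B A : Ω → ℝ}
    (hB : Measurable B) (hA : Measurable A) (θ : ℝ) :
    jointLST μ B A ((θ : ℂ) * Complex.I) (-((θ : ℂ) * Complex.I)) =
      charFun (μ.map fun ω => B ω - A ω) (-θ) := by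
  rw [charFun_apply_real, integral_map (by fun_prop) (by fun_prop), jointLST]
  congr 1
  ext ω
  congr 1
  push_cast
  ring

theorem summable_norm_pow_div {z : ℂ} (hz : ‖z‖ < 1) : Summable fun n : ℕ => ‖z ^ n / (n : ℂ)‖ := by
  refine (summable_geometric_of_lt_one (norm_nonneg z) hz).of_nonneg_of_le
    (fun n => norm_nonneg _) fun n => ?_
  rcases Nat.eq_zero_or_pos n with rfl | hn
  · simp
  · rw [norm_div, norm_pow, Complex.norm_natCast]
    exact div_le_self (by positivity) (by exact_mod_cast hn)

end CorrelatedQueue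

end

theorem mainTheorem3 {Ω : Type*} [MeasurableSpace Ω] (μ : Measure Ω) [IsProbabilityMeasure μ]
    (B A : ℕ → Ω → ℝ)
    (hB : ∀ i, Measurable (B i)) (hA : ∀ i, Measurable (A i))
    (hB0 : ∀ i, ∀ᵐ ω ∂μ, 0 ≤ B i ω) (hA0 : ∀ i, ∀ᵐ ω ∂μ, 0 ≤ A i ω)
    (hindep : iIndepFun (fun i ω => (B i ω, A i ω)) μ)
    (hident : ∀ i, IdentDistrib (fun ω => (B i ω, A i ω)) (fun ω => (B 0 ω, A 0 ω)) μ μ)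
    (hties : ∀ n : ℕ, 1 ≤ n → μ {ω | CorrelatedQueue.walk B A n ω = 0} = 0)
    (z : ℂ) (hz : ‖z‖ < 1) :
    ∃ K : ℂ,
      CorrelatedQueue.HasSphereIntegral
        (fun ξ => Complex.log ((1 - z * CorrelatedQueue.jointLST μ (B 0) (A 0) ξ (-ξ)) / (1 - z)))
        0 K ∧
      CorrelatedQueue.genFun μ (CorrelatedQueue.numServed B A) z =
        1 - (1 - z) * Complex.exp (1 / (2 * Real.pi * Complex.I) * K) := by
  open CorrelatedQueue in
  set ν : Measure ℝ := μ.map fun ω => B 0 ω - A 0 ω with hν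
  have : IsProbabilityMeasure ν :=
    Measure.isProbabilityMeasure_map ((hB 0).sub (hA 0)).aemeasurable
  set c : ℕ → ℂ := fun n => z ^ n / n with hcdef
  have hc : Summable fun n => ‖c n‖ := summable_norm_pow_div hz
  set φ : ℂ → ℂ := fun ξ => Complex.log ((1 - z * jointLST μ (B 0) (A 0) ξ (-ξ)) / (1 - z)) with hφdef
  have hz1 : 1 - z ≠ 0 := fun h => by
    have := re_one_sub_pos hz
    simp [h] at this
  have hφ : ∀ θ : ℝ, φ ((θ : ℂ) * Complex.I) = charSeries (walkLaw ν) c θ := fun θ => by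
    simp only [hφdef]
    rw [jointLST_mul_I (hB 0) (hA 0), ← hν,
      ← (hasSum_log_one_sub_div hz (norm_charFun_le_one (μ := ν) (-θ))).tsum_eq, charSeries]
    simp only [charFun_walkLaw, Pi.pow_apply, hcdef]
  have hφ' : (fun θ : ℝ => φ ((θ : ℂ) * Complex.I)) = charSeries (walkLaw ν) c := funext hφ
  have hφ0 : φ 0 = 0 := by
    simp [hφdef, jointLST, div_self hz1]
  have hmean := tendsto_mean_charSeries (σ := walkLaw ν) hc
  rw [← hφ'] at hmean
  refine ⟨_, ⟨by rw [hφ']; exact (continuous_charSeries hc).locallyIntegrable, _, _,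
    hasDoublePV_charSeries hc hφ, hmean, rfl⟩, ?_⟩
  have hneg : ∀ n, (walkLaw ν n).real (Set.Iio 0) = μ.real {ω | walk B A n ω < 0} := fun n => by
    rw [← map_walk hB hA hindep hident, map_measureReal_apply (measurable_walk hB hA n)
      measurableSet_Iio]
    rfl
  -- The walk does sit at 0 at time 0, but there the weight z⁰/0 is 0; at later times ties are
  -- excluded.
  have hzero : ∀ n, c n * ((walkLaw ν n).real {0} : ℂ) = 0 := fun n => by
    rcases Nat.eq_zero_or_pos n with rfl | hn
    · simp [hcdef]
    · rw [← map_walk hB hA hindep hident, map_measureReal_apply (measurable_walk hB hA n)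
        (measurableSet_singleton _), measureReal_def]
      have := hties n hn
      rw [show walk B A n ⁻¹' {0} = {ω | walk B A n ω = 0} from rfl, this]
      simp
  have s0 : Summable c := hc.of_norm
  have s1 : Summable fun n => c n * ((walkLaw ν n).real (Set.Iio 0) : ℂ) :=
    hc.of_norm_bounded fun n => by
      rw [norm_mul, Complex.norm_real, Real.norm_of_nonneg measureReal_nonneg]
      exact mul_le_of_le_one_right (norm_nonneg _) measureReal_le_one
  have hJ : ∑' n, c n *
      ((Real.pi / 2 * (1 - (walkLaw ν n).real {0} - 2 * (walkLaw ν n).real (Set.Iio 0)) : ℝ) : ℂ) =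
      Real.pi / 2 * (∑' n, c n) - Real.pi * ∑' n, c n * ((walkLaw ν n).real (Set.Iio 0) : ℂ) := by
    rw [← tsum_mul_left, ← tsum_mul_left, ← (s0.mul_left _).tsum_sub (s1.mul_left _)]
    refine tsum_congr fun n => ?_
    push_cast
    linear_combination (-(Real.pi / 2 : ℂ)) * hzero n
  have hM : ∑' n, c n * ((1 - (walkLaw ν n).real {0} : ℝ) : ℂ) = ∑' n, c n := by
    refine tsum_congr fun n => ?_
    push_cast
    linear_combination -hzero n
  have hlog : ∑' n, c n = -Complex.log (1 - z) :=
    (Complex.hasSum_taylorSeries_neg_log hz).tsum_eq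
  have hpi : (Real.pi : ℂ) ≠ 0 := by exact_mod_cast Real.pi_ne_zero
  have hI := Complex.I_ne_zero
  have hSA := one_sub_genFun_numServed hB hA hindep hident hz
  have hE : ∑' n : ℕ, (μ.real {ω | walk B A n ω < 0} : ℂ) / n * z ^ n =
      ∑' n, c n * ((walkLaw ν n).real (Set.Iio 0) : ℂ) := by
    refine tsum_congr fun n => ?_
    rw [hneg, hcdef]
    ring
  rw [hE] at hSA
  rw [hJ, hM, hφ0, hlog]
  set P := ∑' n, c n * ((walkLaw ν n).real (Set.Iio 0) : ℂ)
  -- With L = -log(1 - z), the principal value is πi L - 2πi P and infinity adds πi L, so the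
  -- exponent is L - P. The factor exp L then cancels 1 - z.
  have e : (1 : ℂ) / (2 * Real.pi * Complex.I) * (2 * Complex.I *
      (Real.pi / 2 * -Complex.log (1 - z) - Real.pi * P) +
      Real.pi * Complex.I * -Complex.log (1 - z) -
      (if (0 : ℂ).re = 0 then Real.pi * Complex.I * 0 else 0)) = -Complex.log (1 - z) + -P := by
    simp only [Complex.zero_re, if_true, mul_zero, sub_zero]
    field_simp
    ring
  rw [e, Complex.exp_add, Complex.exp_neg, Complex.exp_log hz1, mul_inv_cancel_left₀ hz1, ← hSA]
  ring
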